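/- **Setting.** Let $d\ge 1$, $z>0$, $C>0$, and let $r$ be a probability measure on $\mathbb R$ with $\operatorname{supp} r\subseteq[-C,C]$ and $r\{0\}=0$. Put $\psi(t)=z\int_{\mathbb R}(e^{ist}-1)\,dr(s)$. Let $\Gamma\subset\mathcal S'(\mathbb R^d)$ be the set of all signed measures $\eta=\sum_y s_y\delta_y$ on $\mathbb R^d$ with finitely many support points in each compact set, $|\eta\{y\}|\le C$ for all $y$, and $\int(1+|x|^2)^{-(d+\varepsilon)/2}\,d|\eta|(x)<\infty$ for all $\varepsilon>0$. Equip $\Gamma$ with the trace of the Borel sigma algebra of $\mathcal S'(\mathbb R^d)$, and let $\mu_0$ be the probability measure on $\Gamma$ determined by $$\int_\Gamma e^{i\langle\eta,f\rangle}\,d\mu_0(\eta)=\exp\Big(\int_{\mathbb R^d}\psi(f(x))\,dx\Big)\qquad\text{for all real Schwartz functions } f .$$ Let $G\in L^1(\mathbb R^d)$ satisfy $G\ge 0$ and $G(-x)=G(x)$. Let $v\in C^2(\mathbb R)$ be concave with $v(0)=0$, with bounded derivative, and monotonically decreasing ($v'\le 0$). For continuous, compactly supported $g\ge0$ on $\mathbb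 R^d$ set $$U_g(\eta)=\int_{\mathbb R^d}v\big((G*\eta)(x)\big)\,g(x)\,dx,\qquad d\mu_g=\frac{e^{-U_g}}{\int_\Gamma e^{-U_g}\,d\mu_0}\,d\mu_0 .$$ A function $F:\Gamma\to\mathbb R$ is called a monotonically increasing observable if $F(\eta)=H(\langle\eta,h_1\rangle,\dots,\langle\eta,h_n\rangle)$ for some $n$, some continuous $H:\mathbb R^n\to\mathbb R$ that is increasing in each argument and satisfies $|H(x)|\le Ke^{\kappa(|x_1|+\dots+|x_n|)}$ for some $K,\kappa>0$, and some continuous $h_1,\dots,h_n\ge0$ on $\mathbb R^d$ with $\sup_x|(1+|x|^2)^N h_l(x)|<\infty$ for all $l$ and all $N\in\mathbb N$. **Proposition.** Let $F$ be a monotonically increasing observable, and let $g_1,g_2$ be continuous, compactly supported functions on $\mathbb R^d$ with $0\le g_1\le g_2$. Then $\mu_{g_1}$ and $\mu_{g_2}$ are well-defined probability measures, $F$ is integrable with respect to both, and $$\int_\Gamma F\,d\mu_{g_1}\le\int_\Gamma F\,d\mu_{g_2}.$$ -/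

import Mathlib

open MeasureTheory Filter
open scoped SchwartzMap

noncomputable section

namespace WeakAttraction

/-- The Euclidean space `ℝ^d`. -/
abbrev Space (d : ℕ) : Type := EuclideanSpace ℝ (Fin d)

/-- The space `S'(ℝ^d)` of real tempered distributions, with the topology of pointwise
convergence. -/
abbrev Distr (d : ℕ) : Type := 𝓢(Space d, ℝ) →Lₚₜ[ℝ] ℝ

/-- The space `Γ = Γ^C` of configurations: signed measures `η = ∑_y s_y δ_y` on `ℝ^d`, encoded by
their charges `s_y = η{y}`, with only finitely many support points in every compact set, with
`|η{y}| ≤ C` for all `y`, and with `∫ (1 + |x|²)^{-(d+ε)/2} d|η|(x) < ∞` for all `ε > 0`. -/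
structure Config (d : ℕ) (C : ℝ) where
  /-- the charge `η{y}` sitting at the point `y` -/
  charge : Space d → ℝ
  finite_on_compact : ∀ A : Set (Space d), IsCompact A → (A ∩ Function.support charge).Finite
  abs_charge_le : ∀ y, |charge y| ≤ C
  summable_weight : ∀ ε : ℝ, 0 < ε →
    Summable fun y => (1 + ‖y‖ ^ 2) ^ (-((d : ℝ) + ε) / 2) * |charge y|

namespace Config

variable {d : ℕ} {C : ℝ}

/-- The pairing `⟨η, h⟩ = ∫ h dη = ∑_y η{y} h(y)`. -/
def pair (η : Config d C) (h : Space d → ℝ) : ℝ := ∑' y, η.charge y * h y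

lemma abs_mul_le (η : Config d C) (f : 𝓢(Space d, ℝ)) (y : Space d) :
    |η.charge y * f y| ≤
      (2 ^ (d + 1) * ((Finset.Iic (d + 1, 0)).sup (schwartzSeminormFamily ℝ (Space d) ℝ)) f) *
        ((1 + ‖y‖ ^ 2) ^ (-((d : ℝ) + 1) / 2) * |η.charge y|) := by
  have h1 := SchwartzMap.one_add_le_sup_seminorm_apply (𝕜 := ℝ) (m := (d + 1, 0))
    (k := d + 1) (n := 0) le_rfl le_rfl f y
  rw [norm_iteratedFDeriv_zero, Real.norm_eq_abs] at h1
  set S := 2 ^ (d + 1) * ((Finset.Iic (d + 1, 0)).sup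
    (schwartzSeminormFamily ℝ (Space d) ℝ)) f with hS
  have h1' : (1 + ‖y‖) ^ (d + 1) * |f y| ≤ S := h1
  have hn : 0 ≤ ‖y‖ := norm_nonneg y
  have hpos : (0 : ℝ) < 1 + ‖y‖ ^ 2 := by positivity
  have h2 : (1 + ‖y‖ ^ 2) ^ (((d : ℝ) + 1) / 2) ≤ (1 + ‖y‖) ^ (d + 1) := by
    have h3 : (1 + ‖y‖ ^ 2) ≤ (1 + ‖y‖) ^ 2 := by nlinarith
    calc (1 + ‖y‖ ^ 2) ^ (((d : ℝ) + 1) / 2)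
        ≤ ((1 + ‖y‖) ^ 2) ^ (((d : ℝ) + 1) / 2) :=
          Real.rpow_le_rpow hpos.le h3 (by positivity)
      _ = (1 + ‖y‖) ^ (d + 1) := by
          rw [← Real.rpow_natCast (1 + ‖y‖) 2, ← Real.rpow_mul (by positivity),
            ← Real.rpow_natCast]
          congr 1
          push_cast
          ring
  have h4 : (1 + ‖y‖ ^ 2) ^ (-((d : ℝ) + 1) / 2) =
      ((1 + ‖y‖ ^ 2) ^ (((d : ℝ) + 1) / 2))⁻¹ := by
    rw [neg_div, Real.rpow_neg hpos.le]
  have hw : 0 < (1 + ‖y‖ ^ 2) ^ (((d : ℝ) + 1) / 2) := Real.rpow_pos_of_pos hpos _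
  have h5 : |f y| ≤ S * ((1 + ‖y‖ ^ 2) ^ (((d : ℝ) + 1) / 2))⁻¹ := by
    rw [← div_eq_mul_inv, le_div_iff₀ hw]
    calc |f y| * _ ≤ |f y| * (1 + ‖y‖) ^ (d + 1) :=
          mul_le_mul_of_nonneg_left h2 (abs_nonneg _)
      _ ≤ S := by rw [mul_comm]; exact h1'
  rw [abs_mul, h4, ← mul_assoc, mul_comm]
  exact mul_le_mul_of_nonneg_right h5 (abs_nonneg _)

lemma summable_pair (η : Config d C) (f : 𝓢(Space d, ℝ)) :
    Summable fun y => η.charge y * f y :=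
  Summable.of_norm_bounded ((η.summable_weight 1 one_pos).mul_left _) (η.abs_mul_le f)

/-- The embedding `Γ → S'(ℝ^d)`, `η ↦ (f ↦ ⟨η, f⟩)`. -/
def toDistr (η : Config d C) : Distr d :=
  ContinuousLinearMap.toPointwiseConvergenceCLM ℝ (RingHom.id ℝ) 𝓢(Space d, ℝ) ℝ
    (SchwartzMap.mkCLMtoNormedSpace (𝕜 := ℝ) (σ := RingHom.id ℝ)
      (fun f : 𝓢(Space d, ℝ) => η.pair f)
      (fun f g => by
        simp only [pair, add_apply, mul_add]
        exact (η.summable_pair f).tsum_add (η.summable_pair g))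
      (fun a f => by
        simp only [pair, smul_apply, smul_eq_mul, RingHom.id_apply, ← tsum_mul_left]
        exact tsum_congr fun y => by ring)
      ⟨Finset.Iic (d + 1, 0),
        2 ^ (d + 1) * ∑' y, (1 + ‖y‖ ^ 2) ^ (-((d : ℝ) + 1) / 2) * |η.charge y|,
        mul_nonneg (by positivity) (tsum_nonneg fun y => by positivity), fun f => by
          refine (tsum_of_norm_bounded
            (((η.summable_weight 1 one_pos).mul_left _).hasSum) (η.abs_mul_le f)).trans ?_
          rw [tsum_mul_left]
          exact le_of_eq (by ring)⟩)

@[simp] lemma toDistr_apply (η : Config d C) (f : 𝓢(Space d, ℝ)) :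
    η.toDistr f = η.pair f := rfl

/-- The trace on `Γ` of the Borel sigma algebra of `S'(ℝ^d)`. -/
instance : MeasurableSpace (Config d C) := (borel (Distr d)).comap toDistr

end Config

/-- The Lévy characteristic `ψ(t) = z ∫ (e^{ist} - 1) dr(s)`. -/
def levyChar (z : ℝ) (r : Measure ℝ) (t : ℝ) : ℂ :=
  z * ∫ s, (Complex.exp (Complex.I * s * t) - 1) ∂r

/-- `μ₀` is the law on `Γ` of the free gas with activity `z` and charge distribution `r`: the
probability measure with `∫ e^{i⟨η,f⟩} dμ₀(η) = exp (∫ ψ(f(x)) dx)` for all real Schwartz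
functions `f`. -/
structure IsFreeGas {d : ℕ} {C : ℝ} (z : ℝ) (r : Measure ℝ) (μ₀ : Measure (Config d C)) :
    Prop where
  isProbabilityMeasure : IsProbabilityMeasure μ₀
  charFun_eq : ∀ f : 𝓢(Space d, ℝ),
    ∫ η, Complex.exp (Complex.I * (η.toDistr f : ℝ)) ∂μ₀
      = Complex.exp (∫ x, levyChar z r (f x))

/-- The static field `φ(x) = (G * η)(x) = ∑_y η{y} G(x - y)`. -/
def field {d : ℕ} {C : ℝ} (G : Space d → ℝ) (η : Config d C) (x : Space d) : ℝ :=
  η.pair fun y => G (x - y)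

/-- The interaction `U_g(η) = ∫ v(φ(x)) g(x) dx` with cut-off `g`. -/
def interaction {d : ℕ} {C : ℝ} (G : Space d → ℝ) (v : ℝ → ℝ) (g : Space d → ℝ)
    (η : Config d C) : ℝ :=
  ∫ x, v (field G η x) * g x

/-- The Gibbs measure `dμ_g = e^{-U_g} / (∫ e^{-U_g} dμ₀) dμ₀`. -/
def gibbs {d : ℕ} {C : ℝ} (G : Space d → ℝ) (v : ℝ → ℝ) (μ₀ : Measure (Config d C))
    (g : Space d → ℝ) : Measure (Config d C) :=
  μ₀.tilted fun η => -interaction G v g η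

/-- Fast falling functions: continuous, and `(1 + |x|²)^N h(x)` is bounded for each `N`. -/
def IsFastFalling {d : ℕ} (h : Space d → ℝ) : Prop :=
  Continuous h ∧ ∀ N : ℕ, ∃ B : ℝ, ∀ x, |(1 + ‖x‖ ^ 2) ^ N * h x| ≤ B

/-- Exponentially bounded functions on `ℝ^n`. -/
def IsExpBounded {n : ℕ} (H : (Fin n → ℝ) → ℝ) : Prop :=
  ∃ κ K : ℝ, 0 < κ ∧ 0 < K ∧ ∀ x, |H x| ≤ K * Real.exp (κ * ∑ i, |x i|)

/-- Monotonically increasing observables: `F(η) = H(⟨η,h₁⟩, …, ⟨η,h_n⟩)` with `H` continuous,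
exponentially bounded and increasing in each argument, and `h_l ≥ 0` fast falling. -/
def IsIncreasingObservable {d : ℕ} {C : ℝ} (F : Config d C → ℝ) : Prop :=
  ∃ (n : ℕ) (H : (Fin n → ℝ) → ℝ) (h : Fin n → Space d → ℝ),
    Continuous H ∧ IsExpBounded H ∧
    (∀ (x : Fin n → ℝ) (l : Fin n), Monotone fun t : ℝ => H (Function.update x l t)) ∧
    (∀ l, IsFastFalling (h l)) ∧ (∀ l x, 0 ≤ h l x) ∧
    ∀ η, F η = H fun l => η.pair (h l)

end WeakAttraction

end

/-! ### The four functions theorem for product measures on powers of the real line. -/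

section FourFunctions

open scoped ENNReal

/-! Write `U₁`, `U₂` for the interactions with cut-offs `g₁ ≤ g₂`. After clearing the partition
functions, the claim is the correlation inequality `∫ F e^{-U₁} · ∫ e^{-U₂} ≤ ∫ F e^{-U₂} · ∫
e^{-U₁}` under `μ₀`. Cut space into small cubes and replace `η` by the vector `ξ` of the charges of
the cubes. Under `μ₀` these charges are independent and compound Poisson
(`IsFreeGas.map_cellCharge`), so the discretised claim concerns a product measure on a finite power
of `ℝ`. There the four functions theorem of Ahlswede and Daykin (`lintegral_four_functions_pi`)
reduces it, for `F ≥ 0`, to the pointwise bound `F ξ · e^{-U₁ ξ} · e^{-U₂ ζ} ≤ F (ξ ⊔ ζ) · e^{-U₂ (ξ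
⊔ ζ)} · e^{-U₁ (ξ ⊓ ζ)}`.

Since `F` is increasing, only `U₂ (ξ ⊔ ζ) + U₁ (ξ ⊓ ζ) ≤ U₁ ξ + U₂ ζ` matters. Fix `x`, and let `p,
q, s, t` be the fields at `x` of `ξ, ζ, ξ ⊔ ζ, ξ ⊓ ζ`. The field is linear, and increasing because
`G ≥ 0`, so `p + q = s + t` and `p, q ≤ s`. Concavity gives `v s + v t ≤ v p + v q`, monotonicity
gives `v s ≤ v q`; multiply by `g₁` and by `g₂ - g₁`, add, and integrate over `x`
(`IsAttractive.mul_add_mul_le`, `lintegral_correlation_le`).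

The rest is passage to the limit: first in the mesh for continuous compactly supported `G`, then in
`G` along an `L¹` approximation. Both limits are dominated by `e^{2S}` with `S = ⟨|η|, k⟩` for a
suitable `k`. Its integrability comes from the bounded jumps of the compound Poisson laws, via Fatou
(`IsFreeGas.exists_integrable_majorant`). Observables of variable sign are handled by truncation
from below and a shift. -/

lemma ENNReal.add_le_add_of_mul_le_mul {a b c d : ℝ≥0∞} (hac : a ≤ c) (hbc : b ≤ c)
    (h : a * b ≤ c * d) : a + b ≤ c + d := by
  rcases eq_or_ne c ∞ with rfl | hc
  · simp
  rcases eq_or_ne d ∞ with rfl | hd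
  · simp
  lift c to NNReal using hc
  lift d to NNReal using hd
  lift a to NNReal using ne_top_of_le_ne_top ENNReal.coe_ne_top hac
  lift b to NNReal using ne_top_of_le_ne_top ENNReal.coe_ne_top hbc
  norm_cast at *
  rcases eq_or_ne c 0 with rfl | hc
  · simp_all
  · rw [← NNReal.coe_le_coe] at *
    have hc' : (0 : ℝ) < c := lt_of_le_of_ne c.2 fun h => hc (NNReal.eq h.symm)
    push_cast at *
    by_contra! hlt
    -- The point is `c (c + d - a - b) ≥ c² + a b - c a - c b = (c - a) (c - b) ≥ 0`, with `c > 0`.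
    nlinarith [mul_nonneg (sub_nonneg.2 hac) (sub_nonneg.2 hbc), mul_lt_mul_of_pos_left hlt hc']

/-- The one-dimensional four functions theorem for integrals. -/
lemma lintegral_four_functions_real {ν : Measure ℝ} [SFinite ν] {f₁ f₂ f₃ f₄ : ℝ → ℝ≥0∞}
    (h₁ : Measurable f₁) (h₂ : Measurable f₂) (h₃ : Measurable f₃) (h₄ : Measurable f₄)
    (h : ∀ x y, f₁ x * f₂ y ≤ f₃ (x ⊔ y) * f₄ (x ⊓ y)) :
    (∫⁻ x, f₁ x ∂ν) * ∫⁻ x, f₂ x ∂ν ≤ (∫⁻ x, f₃ x ∂ν) * ∫⁻ x, f₄ x ∂ν := by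
  -- Symmetrise over the exchange of the two variables: `f₁ x * f₂ y` alone need not be dominated by
  -- `f₃ x * f₄ y`, but the symmetrised sums are comparable pointwise.
  have key : ∀ f g : ℝ → ℝ≥0∞, Measurable f → Measurable g →
      2 * ((∫⁻ x, f x ∂ν) * ∫⁻ x, g x ∂ν) =
        ∫⁻ p, (f p.1 * g p.2 + f p.2 * g p.1) ∂(ν.prod ν) := by
    intro f g hf hg
    rw [lintegral_add_left (by fun_prop), lintegral_prod_mul hf.aemeasurable hg.aemeasurable]
    simp_rw [mul_comm (f _) (g _)]
    rw [lintegral_prod_mul hg.aemeasurable hf.aemeasurable, two_mul,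
      mul_comm (∫⁻ x, g x ∂ν)]
  have h2 : 2 * ((∫⁻ x, f₁ x ∂ν) * ∫⁻ x, f₂ x ∂ν) ≤ 2 * ((∫⁻ x, f₃ x ∂ν) * ∫⁻ x, f₄ x ∂ν) := by
    rw [key _ _ h₁ h₂, key _ _ h₃ h₄]
    refine lintegral_mono fun p => ?_
    obtain ⟨x, y⟩ := p
    have aux : ∀ x y : ℝ, x ≤ y →
        f₁ x * f₂ y + f₁ y * f₂ x ≤ f₃ y * f₄ x + f₃ x * f₄ y := by
      intro x y hxy
      have a := h x y
      have b := h y x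
      rw [sup_eq_right.2 hxy, inf_eq_left.2 hxy] at a
      rw [sup_eq_left.2 hxy, inf_eq_right.2 hxy] at b
      refine ENNReal.add_le_add_of_mul_le_mul a b ?_
      have c := h x x
      have d := h y y
      simp only [sup_idem, inf_idem] at c d
      calc f₁ x * f₂ y * (f₁ y * f₂ x) = (f₁ x * f₂ x) * (f₁ y * f₂ y) := by ring
        _ ≤ (f₃ x * f₄ x) * (f₃ y * f₄ y) := mul_le_mul' c d
        _ = f₃ y * f₄ x * (f₃ x * f₄ y) := by ring
    rcases le_total x y with hxy | hxy
    · exact (aux x y hxy).trans_eq (add_comm _ _)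
    · exact (add_comm _ _).trans_le (aux y x hxy)
  exact (ENNReal.mul_le_mul_iff_right two_ne_zero ENNReal.ofNat_ne_top).1 h2

/-- The four functions theorem for integrals with respect to product measures. -/
theorem lintegral_four_functions_pi {ι : Type*} [Fintype ι] {ν : ι → Measure ℝ}
    [∀ i, SigmaFinite (ν i)] {f₁ f₂ f₃ f₄ : (ι → ℝ) → ℝ≥0∞}
    (h₁ : Measurable f₁) (h₂ : Measurable f₂) (h₃ : Measurable f₃) (h₄ : Measurable f₄)
    (h : ∀ x y, f₁ x * f₂ y ≤ f₃ (x ⊔ y) * f₄ (x ⊓ y)) :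
    (∫⁻ x, f₁ x ∂Measure.pi ν) * ∫⁻ x, f₂ x ∂Measure.pi ν ≤
      (∫⁻ x, f₃ x ∂Measure.pi ν) * ∫⁻ x, f₄ x ∂Measure.pi ν := by
  classical
  -- The hypothesis survives integrating out one coordinate: this is the one-dimensional theorem
  -- with the other coordinates of `x` and `y` frozen. Marginals remain functions on the full space,
  -- so the induction stays within one type.
  have key : ∀ s : Finset ι, ∀ f₁ f₂ f₃ f₄ : (ι → ℝ) → ℝ≥0∞, Measurable f₁ → Measurable f₂ →
      Measurable f₃ → Measurable f₄ → (∀ x y, f₁ x * f₂ y ≤ f₃ (x ⊔ y) * f₄ (x ⊓ y)) →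
      ∀ x y, (∫⋯∫⁻_s, f₁ ∂ν) x * (∫⋯∫⁻_s, f₂ ∂ν) y ≤
        (∫⋯∫⁻_s, f₃ ∂ν) (x ⊔ y) * (∫⋯∫⁻_s, f₄ ∂ν) (x ⊓ y) := by
    intro s
    induction s using Finset.induction_on with
    | empty => intro f₁ f₂ f₃ f₄ _ _ _ _ h; simpa using h
    | insert i s hi ih =>
      intro f₁ f₂ f₃ f₄ h₁ h₂ h₃ h₄ h
      rw [lmarginal_insert' _ h₁ hi, lmarginal_insert' _ h₂ hi, lmarginal_insert' _ h₃ hi,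
        lmarginal_insert' _ h₄ hi]
      have hm : ∀ f : (ι → ℝ) → ℝ≥0∞, Measurable f →
          Measurable fun x => ∫⁻ t, f (Function.update x i t) ∂ν i := by
        intro f hf
        have : Measurable fun p : (ι → ℝ) × ℝ => f (Function.update p.1 i p.2) :=
          hf.comp measurable_update'
        exact this.lintegral_prod_right'
      refine ih _ _ _ _ (hm _ h₁) (hm _ h₂) (hm _ h₃) (hm _ h₄) fun x y => ?_
      refine lintegral_four_functions_real (h₁.comp (measurable_update x))
        (h₂.comp (measurable_update y)) (h₃.comp (measurable_update _))
        (h₄.comp (measurable_update _)) fun s t => ?_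
      have := h (Function.update x i s) (Function.update y i t)
      convert this using 3
      · ext j; by_cases hj : j = i
        · subst hj; simp
        · simp [hj]
      · ext j; by_cases hj : j = i
        · subst hj; simp
        · simp [hj]
  have := key Finset.univ _ _ _ _ h₁ h₂ h₃ h₄ h 0 0
  simpa only [lmarginal_univ] using this

end FourFunctions

/-! ### Compound Poisson laws: exponential moments and characteristic functions. -/

section CompoundPoisson

open scoped ENNReal NNReal

/-- The `n`-fold convolution power of a measure on the real line. -/
noncomputable def convPow (r : Measure ℝ) (n : ℕ) : Measure ℝ :=
  (fun ρ => r.conv ρ)^[n] (Measure.dirac 0)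

lemma convPow_succ (r : Measure ℝ) (n : ℕ) : convPow r (n + 1) = r.conv (convPow r n) :=
  Function.iterate_succ_apply' _ _ _

instance isProbabilityMeasure_convPow (r : Measure ℝ) [IsProbabilityMeasure r] (n : ℕ) :
    IsProbabilityMeasure (convPow r n) := by
  induction n with
  | zero => exact Measure.dirac.isProbabilityMeasure
  | succ n ih => rw [convPow_succ]; infer_instance

lemma charFun_convPow (r : Measure ℝ) [IsProbabilityMeasure r] (n : ℕ) (t : ℝ) :
    charFun (convPow r n) t = charFun r t ^ n := by
  induction n with
  | zero => simp [convPow, charFun_dirac]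
  | succ n ih => rw [convPow_succ, charFun_conv, ih, pow_succ']

/-- By `|x + y| ≤ |x| + |y|` the exponential moment is submultiplicative under convolution, and one
jump, being bounded by `C`, contributes at most `exp (a * C)`. -/
lemma lintegral_exp_abs_convPow_le {r : Measure ℝ} [IsProbabilityMeasure r] {C a : ℝ}
    (hrC : r (Set.Icc (-C) C)ᶜ = 0) (ha : 0 ≤ a) (n : ℕ) :
    ∫⁻ x, ENNReal.ofReal (Real.exp (a * |x|)) ∂convPow r n ≤
      ENNReal.ofReal (Real.exp (a * C)) ^ n := by
  induction n with
  | zero => simp [convPow]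
  | succ n ih =>
    have hr : ∫⁻ x, ENNReal.ofReal (Real.exp (a * |x|)) ∂r ≤ ENNReal.ofReal (Real.exp (a * C)) := by
      calc ∫⁻ x, ENNReal.ofReal (Real.exp (a * |x|)) ∂r
          ≤ ∫⁻ _, ENNReal.ofReal (Real.exp (a * C)) ∂r := by
            refine lintegral_mono_ae ?_
            have : ∀ᵐ x ∂r, x ∈ Set.Icc (-C) C := by rwa [ae_iff]
            filter_upwards [this] with x hx
            gcongr
            exact abs_le.2 hx
        _ = _ := by simp
    rw [convPow_succ, Measure.lintegral_conv (by fun_prop)]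
    calc ∫⁻ x, ∫⁻ y, ENNReal.ofReal (Real.exp (a * |x + y|)) ∂convPow r n ∂r
        ≤ ∫⁻ x, ∫⁻ y, ENNReal.ofReal (Real.exp (a * |x|)) *
            ENNReal.ofReal (Real.exp (a * |y|)) ∂convPow r n ∂r := by
          refine lintegral_mono fun x => lintegral_mono fun y => ?_
          simp only
          rw [← ENNReal.ofReal_mul (Real.exp_nonneg _), ← Real.exp_add, ← mul_add]
          gcongr
          exact abs_add_le x y
      _ = (∫⁻ x, ENNReal.ofReal (Real.exp (a * |x|)) ∂r) *
            ∫⁻ y, ENNReal.ofReal (Real.exp (a * |y|)) ∂convPow r n := by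
          rw [lintegral_lintegral_mul (by fun_prop) (by fun_prop)]
      _ ≤ _ := by rw [pow_succ']; gcongr

/-- The compound Poisson distribution with intensity `l` and jump distribution `r`. -/
noncomputable def compoundPoisson (l : ℝ) (r : Measure ℝ) : Measure ℝ :=
  Measure.sum fun n : ℕ => ENNReal.ofReal (Real.exp (-l) * (l ^ n / n.factorial)) • convPow r n

/-- The Poisson generating function: `c = 1` yields the total mass, `c = exp (a * C)` the
exponential moments. -/
lemma hasSum_poisson_weight (l c : ℝ) :
    HasSum (fun n : ℕ => Real.exp (-l) * (l ^ n / n.factorial) * c ^ n)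
      (Real.exp (l * (c - 1))) := by
  have h := (NormedSpace.expSeries_div_hasSum_exp (l * c)).mul_left (Real.exp (-l))
  rw [← Real.exp_eq_exp_ℝ, ← Real.exp_add] at h
  rw [show l * (c - 1) = -l + l * c by ring]
  rwa [show (fun n : ℕ => Real.exp (-l) * (l ^ n / n.factorial) * c ^ n) =
    fun n : ℕ => Real.exp (-l) * ((l * c) ^ n / n.factorial) from
      funext fun n => by rw [mul_pow]; ring]

lemma lintegral_exp_abs_compoundPoisson_le {r : Measure ℝ} [IsProbabilityMeasure r] {C a l : ℝ}
    (hrC : r (Set.Icc (-C) C)ᶜ = 0) (ha : 0 ≤ a) (hl : 0 ≤ l) :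
    ∫⁻ x, ENNReal.ofReal (Real.exp (a * |x|)) ∂compoundPoisson l r ≤
      ENNReal.ofReal (Real.exp (l * (Real.exp (a * C) - 1))) := by
  have hs := hasSum_poisson_weight l (Real.exp (a * C))
  rw [compoundPoisson, lintegral_sum_measure, ← hs.tsum_eq,
    ENNReal.ofReal_tsum_of_nonneg (fun n => by positivity) hs.summable]
  refine ENNReal.tsum_le_tsum fun n => ?_
  rw [lintegral_smul_measure,
    ENNReal.ofReal_mul (p := Real.exp (-l) * (l ^ n / n.factorial)) (by positivity),
    ENNReal.ofReal_pow (Real.exp_nonneg _)]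
  exact mul_le_mul_right (lintegral_exp_abs_convPow_le hrC ha n) _

lemma isProbabilityMeasure_compoundPoisson {r : Measure ℝ} [IsProbabilityMeasure r] {l : ℝ}
    (hl : 0 ≤ l) : IsProbabilityMeasure (compoundPoisson l r) := by
  constructor
  have hs := hasSum_poisson_weight l 1
  simp only [one_pow, mul_one, sub_self, mul_zero, Real.exp_zero] at hs
  simp only [compoundPoisson, Measure.sum_apply _ MeasurableSet.univ, Measure.smul_apply,
    measure_univ, smul_eq_mul, mul_one]
  rw [← ENNReal.ofReal_tsum_of_nonneg (fun n => by positivity) hs.summable, hs.tsum_eq,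
    ENNReal.ofReal_one]

/-- Given `n` jumps the characteristic function is `charFun r t ^ n`; the Poisson weights turn these
powers into an exponential series. With `l = z * volume` of a cube, this is the factor that the free
gas formula assigns to that cube. -/
lemma charFun_compoundPoisson {r : Measure ℝ} [IsProbabilityMeasure r] {l : ℝ}
    (hl : 0 ≤ l) (t : ℝ) :
    charFun (compoundPoisson l r) t = Complex.exp (l * (charFun r t - 1)) := by
  have := isProbabilityMeasure_compoundPoisson (r := r) hl
  rw [charFun_apply_real]
  have hint : Integrable (fun x : ℝ => Complex.exp (t * x * Complex.I)) (compoundPoisson l r) := by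
    refine Integrable.of_bound (C := 1) (by fun_prop) (ae_of_all _ fun x => ?_)
    rw [← Complex.ofReal_mul, Complex.norm_exp_ofReal_mul_I]
  have h1 := hasSum_integral_measure hint
  have h2 := (NormedSpace.expSeries_div_hasSum_exp ((l : ℂ) * charFun r t)).mul_left
    (Complex.exp (-l))
  rw [← Complex.exp_eq_exp_ℂ, ← Complex.exp_add] at h2
  have e : ∀ n : ℕ, ∫ x : ℝ, Complex.exp (t * x * Complex.I)
      ∂(ENNReal.ofReal (Real.exp (-l) * (l ^ n / n.factorial)) • convPow r n) =
        Complex.exp (-l) * ((l * charFun r t) ^ n / n.factorial) := by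
    intro n
    rw [integral_smul_measure, ← charFun_apply_real, charFun_convPow,
      ENNReal.toReal_ofReal (by positivity), mul_pow, Complex.real_smul]
    push_cast
    ring
  simp_rw [e] at h1
  rw [show (l : ℂ) * (charFun r t - 1) = -l + l * charFun r t by ring]
  exact h1.unique h2

end CompoundPoisson

/-! ### The polynomial weight, and the free gas functional beyond Schwartz functions. -/

noncomputable section

namespace WeakAttraction

open scoped Topology ENNReal

/-- The polynomial weight `(1 + |y|²)^{-(d+1)/2}`. -/
def weight {d : ℕ} (y : Space d) : ℝ := (1 + ‖y‖ ^ 2) ^ (-((d : ℝ) + 1) / 2)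

variable {d : ℕ} {C : ℝ}

lemma weight_pos (y : Space d) : 0 < weight y := Real.rpow_pos_of_pos (by positivity) _

lemma continuous_weight : Continuous (weight (d := d)) := by
  unfold weight
  exact Continuous.rpow_const (by fun_prop) fun _ => Or.inl (by positivity)

lemma integrable_weight : Integrable (weight (d := d)) :=
  integrable_rpow_neg_one_add_norm_sq (by simp)

lemma weight_eq_inv (y : Space d) : weight y = ((1 + ‖y‖ ^ 2) ^ (((d : ℝ) + 1) / 2))⁻¹ := by
  rw [weight, neg_div, Real.rpow_neg (by positivity)]

lemma weight_le_one (y : Space d) : weight y ≤ 1 := by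
  rw [weight_eq_inv]
  exact inv_le_one_of_one_le₀ (Real.one_le_rpow (by nlinarith [sq_nonneg ‖y‖]) (by positivity))

lemma weight_le_mul_weight {c : ℝ} (hc : 0 ≤ c) {x y : Space d}
    (h : 1 + ‖y‖ ^ 2 ≤ c * (1 + ‖x‖ ^ 2)) :
    weight x ≤ c ^ (((d : ℝ) + 1) / 2) * weight y := by
  have hx : (0 : ℝ) < (1 + ‖x‖ ^ 2) ^ (((d : ℝ) + 1) / 2) := Real.rpow_pos_of_pos (by positivity) _
  have hy : (0 : ℝ) < (1 + ‖y‖ ^ 2) ^ (((d : ℝ) + 1) / 2) := Real.rpow_pos_of_pos (by positivity) _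
  rw [weight_eq_inv, weight_eq_inv, ← div_eq_mul_inv, le_div_iff₀ hy, inv_mul_le_iff₀ hx, mul_comm,
    ← Real.mul_rpow hc (by positivity)]
  exact Real.rpow_le_rpow (by positivity) h (by positivity)

/-- Comparison with the origin, where the weight is 1. It puts bounded functions supported in a ball
under a multiple of the weight. -/
lemma one_le_mul_weight {R : ℝ} {y : Space d} (h : ‖y‖ ≤ R) :
    1 ≤ (1 + R ^ 2) ^ (((d : ℝ) + 1) / 2) * weight y := by
  have hz : weight (0 : Space d) = 1 := by simp [weight]
  refine hz.ge.trans (weight_le_mul_weight (c := 1 + R ^ 2) (by positivity) ?_)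
  have := norm_nonneg y
  simp only [norm_zero]
  nlinarith

lemma Config.summable_abs_mul_weight (η : Config d C) :
    Summable fun y => |η.charge y| * weight y :=
  (η.summable_weight 1 one_pos).congr fun _ => mul_comm _ _

/-- Dominated convergence for the sum over atoms. Domination by `weight` is enough because every
configuration has finite `|η|`-integral of it: this is `ε = 1` in the definition of `Γ`. -/
lemma Config.tendsto_pair (η : Config d C) {f : ℕ → Space d → ℝ} {φ : Space d → ℝ} {B : ℝ}
    (hB : ∀ m y, |f m y| ≤ B * weight y) (hf : ∀ y, Tendsto (fun m => f m y) atTop (𝓝 (φ y))) :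
    Tendsto (fun m => η.pair (f m)) atTop (𝓝 (η.pair φ)) := by
  refine tendsto_tsum_of_dominated_convergence (η.summable_abs_mul_weight.mul_left B)
    (fun y => (hf y).const_mul _) (Eventually.of_forall fun m y => ?_)
  rw [Real.norm_eq_abs, abs_mul]
  nlinarith [hB m y, abs_nonneg (η.charge y)]

lemma measurable_pair_schwartz (f : 𝓢(Space d, ℝ)) :
    Measurable fun η : Config d C => η.pair f := by
  let : MeasurableSpace (Distr d) := borel (Distr d)
  have : BorelSpace (Distr d) := ⟨rfl⟩
  have h1 : Measurable fun T : Distr d => T f :=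
    (PointwiseConvergenceCLM.evalCLM (RingHom.id ℝ) ℝ f).continuous.measurable
  have h2 : Measurable (Config.toDistr (d := d) (C := C)) := Measurable.of_comap_le le_rfl
  exact h1.comp h2

section LevyChar

variable {z : ℝ} {r : Measure ℝ}

lemma levyChar_eq [IsProbabilityMeasure r] (t : ℝ) :
    levyChar z r t = z * (charFun r t - 1) := by
  have hint : Integrable (fun x : ℝ => Complex.exp (t * x * Complex.I)) r := by
    refine Integrable.of_bound (C := 1) (by fun_prop) (ae_of_all _ fun x => ?_)
    rw [← Complex.ofReal_mul, Complex.norm_exp_ofReal_mul_I]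
  have h : ∀ s : ℝ, Complex.exp (Complex.I * s * t) = Complex.exp (t * s * Complex.I) :=
    fun s => by congr 1; ring
  simp_rw [levyChar, h]
  rw [integral_sub hint (integrable_const _), charFun_apply_real]
  simp

lemma levyChar_zero : levyChar z r 0 = 0 := by simp [levyChar]

lemma continuous_levyChar [IsProbabilityMeasure r] : Continuous (levyChar z r) := by
  have : levyChar z r = fun t => (z : ℂ) * (charFun r t - 1) := funext fun t => levyChar_eq t
  rw [this]
  have : Continuous (charFun r) := continuous_charFun
  fun_prop

/-- Uses `|e^{ist} - 1| ≤ |s t|` and `|s| ≤ C` almost surely. Linearity of the bound in `t` makes `ψ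
∘ f` integrable as soon as `f` is dominated by the weight. -/
lemma norm_levyChar_le [IsProbabilityMeasure r] (hz : 0 ≤ z) (hrC : r (Set.Icc (-C) C)ᶜ = 0)
    (t : ℝ) : ‖levyChar z r t‖ ≤ z * C * |t| := by
  rw [levyChar, norm_mul, Complex.norm_real, Real.norm_of_nonneg hz, mul_assoc]
  refine mul_le_mul_of_nonneg_left ?_ hz
  have : ∀ᵐ s : ℝ ∂r, ‖Complex.exp (Complex.I * s * t) - 1‖ ≤ C * |t| := by
    have : ∀ᵐ x ∂r, x ∈ Set.Icc (-C) C := by rwa [ae_iff]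
    filter_upwards [this] with s hs
    have := Real.norm_exp_I_mul_ofReal_sub_one_le (x := s * t)
    rw [Complex.ofReal_mul, ← mul_assoc] at this
    refine this.trans ?_
    rw [Real.norm_eq_abs, abs_mul]
    exact mul_le_mul_of_nonneg_right (abs_le.2 hs) (abs_nonneg _)
  simpa using norm_integral_le_of_norm_le_const this

/-- The formula for the characteristic functional extends to dominated pointwise limits of
Schwartz functions. -/
lemma IsFreeGas.charFun_eq_of_tendsto {μ₀ : Measure (Config d C)} [IsProbabilityMeasure r]
    (hz : 0 ≤ z) (hrC : r (Set.Icc (-C) C)ᶜ = 0) (hμ₀ : IsFreeGas z r μ₀)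
    {f : ℕ → 𝓢(Space d, ℝ)} {φ : Space d → ℝ} {B : ℝ}
    (hB : ∀ m y, |f m y| ≤ B * weight y) (hf : ∀ y, Tendsto (fun m => f m y) atTop (𝓝 (φ y))) :
    ∫ η : Config d C, Complex.exp ((η.pair φ : ℝ) * Complex.I) ∂μ₀ =
      Complex.exp (∫ x, levyChar z r (φ x)) := by
  have := hμ₀.isProbabilityMeasure
  have hC : 0 ≤ C := by
    by_contra! h
    rw [Set.Icc_eq_empty (by linarith)] at hrC
    simp at hrC
  have h1 : Tendsto (fun m => ∫ η : Config d C, Complex.exp ((η.pair (f m) : ℝ) * Complex.I) ∂μ₀)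
      atTop (𝓝 (∫ η : Config d C, Complex.exp ((η.pair φ : ℝ) * Complex.I) ∂μ₀)) := by
    refine tendsto_integral_of_dominated_convergence (fun _ => 1) (fun m => ?_)
      (integrable_const _) (fun m => ae_of_all _ fun η => ?_) (ae_of_all _ fun η => ?_)
    · have := measurable_pair_schwartz (C := C) (f m)
      exact (Measurable.cexp (by fun_prop)).aestronglyMeasurable
    · rw [Complex.norm_exp_ofReal_mul_I]
    · have hc : Continuous fun x : ℝ => Complex.exp (x * Complex.I) := by fun_prop
      exact (hc.tendsto _).comp (η.tendsto_pair hB hf)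
  have h2 : Tendsto (fun m => ∫ x, levyChar z r (f m x)) atTop
      (𝓝 (∫ x, levyChar z r (φ x))) := by
    refine tendsto_integral_of_dominated_convergence (fun y => z * C * (B * weight y)) (fun m => ?_)
      ((integrable_weight.const_mul _).const_mul _) (fun m => ae_of_all _ fun y => ?_)
      (ae_of_all _ fun y => ?_)
    · exact (continuous_levyChar.comp (f m).continuous).aestronglyMeasurable
    · refine (norm_levyChar_le hz hrC _).trans ?_
      gcongr
      exact hB m y
    · exact (continuous_levyChar.tendsto _).comp (hf y)
  have h3 := (Complex.continuous_exp.tendsto _).comp h2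
  refine tendsto_nhds_unique h1 (h3.congr fun m => ?_)
  have := hμ₀.charFun_eq (f m)
  simp only [Config.toDistr_apply] at this
  rw [Function.comp_apply, ← this]
  simp_rw [mul_comm Complex.I]

end LevyChar

/-! ### Cubic cells and their charges. -/

lemma norm_le_sum_abs (y : Space d) : ‖y‖ ≤ ∑ l, |y l| := by
  have h := (EuclideanSpace.basisFun (Fin d) ℝ).sum_repr y
  calc ‖y‖ = ‖∑ l, y l • EuclideanSpace.basisFun (Fin d) ℝ l‖ := by
        conv_lhs => rw [← h]
        simp
    _ ≤ ∑ l, ‖y l • EuclideanSpace.basisFun (Fin d) ℝ l‖ := norm_sum_le _ _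
    _ = ∑ l, |y l| := by
        refine Finset.sum_congr rfl fun l _ => ?_
        rw [norm_smul, (EuclideanSpace.basisFun (Fin d) ℝ).norm_eq_one, mul_one, Real.norm_eq_abs]

/-- The half-open cube of side length `1 / (n + 1)` with lower corner `j / (n + 1)`. -/
def cell (n : ℕ) (j : Fin d → ℤ) : Set (Space d) :=
  {y | ∀ l, 0 ≤ (n + 1) * y l - j l ∧ (n + 1) * y l - j l < 1}

/-- The index of the cube of side length `1 / (n + 1)` that contains a given point. -/
def cellIndex (n : ℕ) (y : Space d) : Fin d → ℤ := fun l => ⌊(n + 1) * y l⌋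

lemma mem_cell_iff {n : ℕ} {j : Fin d → ℤ} {y : Space d} : y ∈ cell n j ↔ cellIndex n y = j := by
  simp only [cell, Set.mem_ofPred_eq, funext_iff, cellIndex, Int.floor_eq_iff]
  refine forall_congr' fun l => ?_
  constructor <;> rintro ⟨h, h'⟩ <;> constructor <;> linarith

lemma measurableSet_cell (n : ℕ) (j : Fin d → ℤ) : MeasurableSet (cell n j) := by
  have : cell n j = ⋂ l, {y : Space d | 0 ≤ (n + 1) * y l - j l ∧ (n + 1) * y l - j l < 1} := by
    ext y; simp [cell]
  rw [this]
  refine MeasurableSet.iInter fun l => ?_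
  have hm : Measurable fun y : Space d => ((n : ℝ) + 1) * y l - j l := by fun_prop
  exact (measurableSet_le measurable_const hm).inter (measurableSet_lt hm measurable_const)

/-- The hypothesis allows a neighbourhood of the cell so as to cover the supports of the smooth
cut-offs as well. The bound does not depend on `n`, because `n + 1 ≥ 1`. -/
lemma norm_le_of_near_cell {n : ℕ} {j : Fin d → ℤ} {y : Space d}
    (h : ∀ l, |(n + 1) * y l - j l| ≤ 1) : ‖y‖ ≤ ∑ l, (|(j l : ℝ)| + 1) := by
  refine (norm_le_sum_abs y).trans (Finset.sum_le_sum fun l _ => ?_)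
  have h1 : |y l| ≤ |(n + 1) * y l| := by
    rw [abs_mul, abs_of_pos (a := (n : ℝ) + 1) (by positivity)]
    nlinarith [abs_nonneg (y l), Nat.cast_nonneg (α := ℝ) n]
  have h2 := abs_add_le ((n + 1) * y l - j l) (j l)
  rw [sub_add_cancel] at h2
  linarith [h l]

lemma norm_le_of_mem_cell {n : ℕ} {j : Fin d → ℤ} {y : Space d} (h : y ∈ cell n j) :
    ‖y‖ ≤ ∑ l, (|(j l : ℝ)| + 1) :=
  norm_le_of_near_cell (n := n) fun l => abs_le.2 ⟨by linarith [(h l).1], (h l).2.le⟩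

/-- Smooth functions that approximate the indicator function of `[0, 1)`. -/
def smoothIco (m : ℕ) (t : ℝ) : ℝ :=
  Real.smoothTransition ((m + 1) * t + 1) * Real.smoothTransition ((m + 1) * (1 - t))

lemma smoothIco_nonneg (m : ℕ) (t : ℝ) : 0 ≤ smoothIco m t :=
  mul_nonneg (Real.smoothTransition.nonneg _) (Real.smoothTransition.nonneg _)

lemma smoothIco_le_one (m : ℕ) (t : ℝ) : smoothIco m t ≤ 1 :=
  mul_le_one₀ (Real.smoothTransition.le_one _) (Real.smoothTransition.nonneg _)
    (Real.smoothTransition.le_one _)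

lemma contDiff_smoothIco (m : ℕ) : ContDiff ℝ (⊤ : ℕ∞) (smoothIco m) := by
  have h : ContDiff ℝ (⊤ : ℕ∞) Real.smoothTransition := Real.smoothTransition.contDiff
  exact (h.comp (by fun_prop)).mul (h.comp (by fun_prop))

lemma abs_le_one_of_smoothIco_ne_zero {m : ℕ} {t : ℝ} (h : smoothIco m t ≠ 0) : |t| ≤ 1 := by
  have hm : (0 : ℝ) ≤ m := Nat.cast_nonneg m
  contrapose! h
  rcases lt_abs.1 h with h | h
  · rw [smoothIco, Real.smoothTransition.zero_of_nonpos (x := (m + 1) * (1 - t)) (by nlinarith),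
      mul_zero]
  · rw [smoothIco, Real.smoothTransition.zero_of_nonpos (x := (m + 1) * t + 1) (by nlinarith),
      zero_mul]

/-- The shifts in `smoothIco` are placed so that the endpoints come out right: for every `m`, the
first factor is 1 at `t = 0` and the second is 0 at `t = 1`. Convergence must hold at every point,
since atoms of `η` may lie on cell boundaries. -/
lemma tendsto_smoothIco (t : ℝ) :
    Tendsto (fun m => smoothIco m t) atTop (𝓝 (if 0 ≤ t ∧ t < 1 then 1 else 0)) := by
  have hT : ∀ c : ℝ, 0 < c → ∀ᶠ m : ℕ in atTop, 1 ≤ ((m : ℝ) + 1) * c := by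
    intro c hc
    have : Tendsto (fun m : ℕ => ((m : ℝ) + 1) * c) atTop atTop :=
      (tendsto_atTop_add_const_right _ _ tendsto_natCast_atTop_atTop).atTop_mul_const hc
    exact this.eventually_ge_atTop 1
  refine tendsto_const_nhds.congr' ?_
  split_ifs with h
  · filter_upwards [hT (1 - t) (by linarith)] with m hm
    rw [smoothIco, Real.smoothTransition.one_of_one_le hm, Real.smoothTransition.one_of_one_le,
      mul_one]
    nlinarith [h.1, Nat.cast_nonneg (α := ℝ) m]
  · rcases lt_or_ge t 0 with h0 | h0
    · filter_upwards [hT (-t) (by linarith)] with m hm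
      rw [smoothIco, Real.smoothTransition.zero_of_nonpos (x := (m + 1) * t + 1) (by linarith),
        zero_mul]
    · have h1 : 1 ≤ t := by by_contra! h1; exact h ⟨h0, h1⟩
      refine Eventually.of_forall fun m => ?_
      change 0 = smoothIco m t
      rw [smoothIco, Real.smoothTransition.zero_of_nonpos (x := (m + 1) * (1 - t)), mul_zero]
      nlinarith [Nat.cast_nonneg (α := ℝ) m]

/-- Schwartz functions that approximate the indicator function of a cell. -/
def smoothCell (n : ℕ) (j : Fin d → ℤ) (m : ℕ) : 𝓢(Space d, ℝ) :=
  HasCompactSupport.toSchwartzMap (f := fun y => ∏ l, smoothIco m ((n + 1) * y l - j l))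
    (HasCompactSupport.intro (isCompact_closedBall 0 (∑ l, (|(j l : ℝ)| + 1))) fun y hy => by
      by_contra h
      refine hy (mem_closedBall_zero_iff.2 (norm_le_of_near_cell (n := n) fun l => ?_))
      exact abs_le_one_of_smoothIco_ne_zero (Finset.prod_ne_zero_iff.1 h l (Finset.mem_univ l)))
    (contDiff_prod fun l _ => (contDiff_smoothIco m).comp (by fun_prop))

lemma smoothCell_apply (n : ℕ) (j : Fin d → ℤ) (m : ℕ) (y : Space d) :
    smoothCell n j m y = ∏ l, smoothIco m ((n + 1) * y l - j l) := rfl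

lemma abs_smoothCell_le (n : ℕ) (j : Fin d → ℤ) : ∃ B, ∀ m y,
    |smoothCell n j m y| ≤ B * weight y := by
  refine ⟨(1 + (∑ l, (|(j l : ℝ)| + 1)) ^ 2) ^ (((d : ℝ) + 1) / 2), fun m y => ?_⟩
  by_cases h : smoothCell n j m y = 0
  · rw [h, abs_zero]
    exact mul_nonneg (Real.rpow_nonneg (by positivity) _) (weight_pos y).le
  · rw [smoothCell_apply] at h
    have hy : ‖y‖ ≤ ∑ l, (|(j l : ℝ)| + 1) := norm_le_of_near_cell (n := n) fun l =>
      abs_le_one_of_smoothIco_ne_zero (Finset.prod_ne_zero_iff.1 h l (Finset.mem_univ l))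
    refine le_trans ?_ (one_le_mul_weight hy)
    rw [smoothCell_apply, abs_of_nonneg (Finset.prod_nonneg fun l _ => smoothIco_nonneg _ _)]
    exact Finset.prod_le_one (fun l _ => smoothIco_nonneg _ _) fun l _ => smoothIco_le_one _ _

lemma tendsto_smoothCell (n : ℕ) (j : Fin d → ℤ) (y : Space d) :
    Tendsto (fun m => smoothCell n j m y) atTop (𝓝 ((cell n j).indicator 1 y)) := by
  classical
  have h := tendsto_finsetProd (Finset.univ : Finset (Fin d)) fun l _ =>
    tendsto_smoothIco ((n + 1) * y l - j l)
  rw [Finset.prod_ite_zero] at h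
  simpa [Set.indicator_apply, cell, smoothCell_apply] using h

/-- The total charge in a cell. -/
def cellCharge (n : ℕ) (j : Fin d → ℤ) (η : Config d C) : ℝ :=
  η.pair ((cell n j).indicator 1)

lemma measurable_cellCharge (n : ℕ) (j : Fin d → ℤ) :
    Measurable (cellCharge (C := C) n j) := by
  obtain ⟨B, hB⟩ := abs_smoothCell_le n j
  exact measurable_of_tendsto_metrizable (fun m => measurable_pair_schwartz (smoothCell n j m))
    (tendsto_pi_nhds.2 fun η => η.tendsto_pair hB (tendsto_smoothCell n j))

lemma abs_indicator_cell_le (n : ℕ) (j : Fin d → ℤ) : ∃ B, ∀ y : Space d,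
    |(cell n j).indicator (1 : Space d → ℝ) y| ≤ B * weight y := by
  obtain ⟨B, hB⟩ := abs_smoothCell_le n j
  exact ⟨B, fun y => le_of_tendsto (tendsto_smoothCell n j y).abs
    (Eventually.of_forall fun m => hB m y)⟩

/-- The pairing of a configuration with a step function. -/
lemma Config.pair_sum_indicator (η : Config d C) (n : ℕ) (J : Finset (Fin d → ℤ))
    (t : (Fin d → ℤ) → ℝ) :
    η.pair (fun y => ∑ j ∈ J, t j * (cell n j).indicator 1 y) =
      ∑ j ∈ J, t j * cellCharge n j η := by
  have hs : ∀ j, Summable fun y => η.charge y * (cell n j).indicator (1 : Space d → ℝ) y := by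
    intro j
    obtain ⟨B, hB⟩ := abs_indicator_cell_le n j
    refine Summable.of_norm_bounded (η.summable_abs_mul_weight.mul_left B) fun y => ?_
    rw [Real.norm_eq_abs, abs_mul]
    nlinarith [hB y, abs_nonneg (η.charge y)]
  simp only [cellCharge, pair, Finset.mul_sum, ← tsum_mul_left]
  rw [← Summable.tsum_finsetSum fun j _ => (hs j).mul_left (t j)]
  exact tsum_congr fun y => Finset.sum_congr rfl fun j _ => by ring

lemma volume_cell_lt_top (n : ℕ) (j : Fin d → ℤ) : volume (cell n j) < ∞ :=
  (measure_mono fun _ hy => mem_closedBall_zero_iff.2 (norm_le_of_mem_cell hy)).trans_lt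
    (isCompact_closedBall (0 : Space d) _).measure_lt_top

/-! ### The joint law of the cell charges. -/

section Law

variable {z : ℝ} {r : Measure ℝ} [IsProbabilityMeasure r] {μ₀ : Measure (Config d C)}

/-- Under the free gas, the charges of different cells are independent, and each has a compound
Poisson distribution. -/
lemma IsFreeGas.map_cellCharge (hz : 0 ≤ z) (hrC : r (Set.Icc (-C) C)ᶜ = 0)
    (hμ₀ : IsFreeGas z r μ₀) (n : ℕ) (J : Finset (Fin d → ℤ)) :
    μ₀.map (fun η (j : J) => cellCharge n j.1 η) =
      Measure.pi fun j : J => compoundPoisson (z * volume.real (cell n j.1)) r := by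
  have := hμ₀.isProbabilityMeasure
  have hl : ∀ j : J, 0 ≤ z * volume.real (cell n j.1) := fun j => by positivity
  have := fun j : J => isProbabilityMeasure_compoundPoisson (r := r) (hl j)
  have hX : Measurable (fun η (j : J) => cellCharge (C := C) n j.1 η) :=
    measurable_pi_lambda _ fun j => measurable_cellCharge n j.1
  have := Measure.isProbabilityMeasure_map (μ := μ₀) hX.aemeasurable
  -- Independence and the marginal laws follow together from factorisation of the joint
  -- characteristic function, which is the free gas functional at a step function.
  refine charFun_eq_pi_iff.1 fun t => ?_
  rw [charFun_apply, integral_map (by fun_prop) (by fun_prop),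
    integral_map hX.aemeasurable (by fun_prop)]
  classical
  let t' : (Fin d → ℤ) → ℝ := fun j => if h : j ∈ J then t ⟨j, h⟩ else 0
  have ht' : ∀ j : J, t' j.1 = t j := fun j => by simp [t']
  choose B hB using abs_smoothCell_le (d := d) n
  have key := hμ₀.charFun_eq_of_tendsto hz hrC (f := fun m => ∑ j ∈ J, t' j • smoothCell n j m)
    (φ := fun y => ∑ j ∈ J, t' j * (cell n j).indicator 1 y) (B := ∑ j ∈ J, |t' j| * B j)
    (fun m y => by
      simp only [sum_apply, smul_apply, smul_eq_mul]
      rw [Finset.sum_mul]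
      refine (Finset.abs_sum_le_sum_abs _ _).trans (Finset.sum_le_sum fun j _ => ?_)
      rw [abs_mul, mul_assoc]
      exact mul_le_mul_of_nonneg_left (hB j m y) (abs_nonneg _))
    (fun y => by
      simp only [sum_apply, smul_apply, smul_eq_mul]
      exact tendsto_finsetSum _ fun j _ => (tendsto_smoothCell n j y).const_mul _)
  have e1 : ∀ η : Config d C,
      inner ℝ (WithLp.toLp 2 fun j : J => cellCharge n j.1 η) t =
        η.pair (fun y => ∑ j ∈ J, t' j * (cell n j).indicator 1 y) := by
    intro η
    rw [η.pair_sum_indicator, PiLp.inner_apply, ← Finset.sum_coe_sort J]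
    refine Finset.sum_congr rfl fun j _ => ?_
    simp [ht']
  -- `ψ` passes through the sum although it is not additive: the cells are disjoint, so at most one
  -- term is nonzero at `x`, and `ψ 0 = 0`.
  have e2 : ∀ x : Space d, levyChar z r (∑ j ∈ J, t' j * (cell n j).indicator 1 x) =
      ∑ j ∈ J, (cell n j).indicator (fun _ => levyChar z r (t' j)) x := by
    intro x
    have h : ∀ j, x ∈ cell n j ↔ cellIndex n x = j := fun j => mem_cell_iff
    by_cases hx : cellIndex n x ∈ J
    · rw [Finset.sum_eq_single_of_mem _ hx, Finset.sum_eq_single_of_mem _ hx]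
      · simp [h]
      · intro j _ hj
        simp [h, hj.symm]
      · intro j _ hj
        simp [h, hj.symm]
    · rw [Finset.sum_eq_zero, Finset.sum_eq_zero, levyChar_zero]
      · intro j hj
        have : cellIndex n x ≠ j := fun h => hx (h ▸ hj)
        simp [h, this]
      · intro j hj
        have : cellIndex n x ≠ j := fun h => hx (h ▸ hj)
        simp [h, this]
  simp_rw [e1]
  rw [key]
  simp_rw [e2]
  rw [integral_finsetSum _ fun j _ =>
    (integrable_indicator_iff (measurableSet_cell n j)).2
      (integrableOn_const (volume_cell_lt_top n j).ne), Complex.exp_sum, ← Finset.prod_coe_sort J]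
  refine Finset.prod_congr rfl fun j _ => ?_
  rw [integral_indicator (measurableSet_cell n j.1), setIntegral_const, ht', levyChar_eq,
    charFun_compoundPoisson (hl j), Complex.real_smul]
  congr 1
  push_cast
  ring

end Law

end WeakAttraction

end

/-! ### Cell averages and step approximations. -/

noncomputable section

namespace WeakAttraction

open scoped Topology ENNReal

variable {d : ℕ} {C : ℝ}

lemma volume_cell_ne_zero (n : ℕ) (j : Fin d → ℤ) : volume (cell n j) ≠ 0 := by
  set U : Set (Space d) := ⋂ l, {y | (n + 1) * y l - j l ∈ Set.Ioo (0 : ℝ) 1} with hU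
  have hUo : IsOpen U := isOpen_iInter_of_finite fun l =>
    isOpen_Ioo.preimage (f := fun y : Space d => ((n : ℝ) + 1) * y l - j l) (by fun_prop)
  have hUc : U ⊆ cell n j := fun y hy l => by
    have := Set.mem_iInter.1 hy l
    exact ⟨this.1.le, this.2⟩
  have hUne : U.Nonempty := by
    refine ⟨WithLp.toLp 2 fun l => ((j l : ℝ) + 1 / 2) / (n + 1), Set.mem_iInter.2 fun l => ?_⟩
    have : ((n : ℝ) + 1) ≠ 0 := by positivity
    change ((n : ℝ) + 1) * (((j l : ℝ) + 1 / 2) / (n + 1)) - j l ∈ Set.Ioo (0 : ℝ) 1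
    rw [mul_div_cancel₀ _ this]
    constructor <;> norm_num
  exact ((hUo.measure_pos volume hUne).trans_le (measure_mono hUc)).ne'

lemma norm_sub_le_of_mem_cell {n : ℕ} {j : Fin d → ℤ} {x y : Space d} (hx : x ∈ cell n j)
    (hy : y ∈ cell n j) : ‖x - y‖ ≤ d / (n + 1) := by
  have hn : (0 : ℝ) < n + 1 := by positivity
  calc ‖x - y‖ ≤ ∑ l, |(x - y) l| := norm_le_sum_abs _
    _ ≤ ∑ _l : Fin d, 1 / ((n : ℝ) + 1) := by
        refine Finset.sum_le_sum fun l _ => ?_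
        rw [le_div_iff₀ hn, mul_comm]
        nth_rw 1 [← abs_of_pos hn]
        rw [← abs_mul, PiLp.sub_apply, mul_sub]
        have h1 := hx l
        have h2 := hy l
        exact abs_le.2 ⟨by linarith, by linarith⟩
    _ = d / (n + 1) := by simp [div_eq_mul_inv]

lemma norm_sub_le_dim_of_mem_cell {n : ℕ} {j : Fin d → ℤ} {x y : Space d} (hx : x ∈ cell n j)
    (hy : y ∈ cell n j) : ‖x - y‖ ≤ d := by
  refine (norm_sub_le_of_mem_cell hx hy).trans (div_le_self (by positivity) ?_)
  linarith [Nat.cast_nonneg (α := ℝ) n]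

lemma tendsto_mesh : Tendsto (fun n : ℕ => (d : ℝ) / (n + 1)) atTop (𝓝 0) :=
  tendsto_const_nhds.div_atTop (tendsto_atTop_add_const_right _ _ tendsto_natCast_atTop_atTop)

/-- The average of a function over a cell. -/
def cellAverage (n : ℕ) (j : Fin d → ℤ) (h : Space d → ℝ) : ℝ := ⨍ y in cell n j, h y

lemma integrableOn_cell {h : Space d → ℝ} (hh : Continuous h) (n : ℕ) (j : Fin d → ℤ) :
    IntegrableOn h (cell n j) :=
  (hh.locallyIntegrable.integrableOn_isCompact (isCompact_closedBall 0 _)).mono_set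
    fun _ hy => mem_closedBall_zero_iff.2 (norm_le_of_mem_cell hy)

lemma cellAverage_mem {h : Space d → ℝ} (hh : Continuous h) {n : ℕ} {j : Fin d → ℤ} {s : Set ℝ}
    (hs : Convex ℝ s) (hsc : IsClosed s) (hmem : ∀ y ∈ cell n j, h y ∈ s) :
    cellAverage n j h ∈ s :=
  hs.set_average_mem hsc (volume_cell_ne_zero n j) (volume_cell_lt_top n j).ne
    ((ae_restrict_iff' (measurableSet_cell n j)).2 (ae_of_all _ hmem)) (integrableOn_cell hh n j)

lemma cellAverage_nonneg {h : Space d → ℝ} (hh : ∀ y, 0 ≤ h y) (n : ℕ) (j : Fin d → ℤ) :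
    0 ≤ cellAverage n j h := by
  rw [cellAverage, setAverage_eq]
  exact smul_nonneg (by positivity) (integral_nonneg hh)

lemma volume_mul_cellAverage (h : Space d → ℝ) (n : ℕ) (j : Fin d → ℤ) :
    volume.real (cell n j) * cellAverage n j h = ∫ y in cell n j, h y := by
  have : volume.real (cell n j) ≠ 0 :=
    ENNReal.toReal_ne_zero.2 ⟨volume_cell_ne_zero n j, (volume_cell_lt_top n j).ne⟩
  rw [cellAverage, setAverage_eq, smul_eq_mul, mul_inv_cancel_left₀ this]

lemma tendsto_cellAverage {h : Space d → ℝ} (hh : Continuous h) (y : Space d) :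
    Tendsto (fun n => cellAverage n (cellIndex n y) h) atTop (𝓝 (h y)) := by
  rw [Metric.tendsto_atTop']
  intro ε hε
  obtain ⟨δ, hδ, hc⟩ := Metric.continuous_iff.1 hh y (ε / 2) (by positivity)
  obtain ⟨N, hN⟩ := eventually_atTop.1 ((tendsto_order.1 (tendsto_mesh (d := d))).2 δ hδ)
  refine ⟨N, fun n hn => ?_⟩
  have h2 : cellAverage n (cellIndex n y) h ∈ Metric.closedBall (h y) (ε / 2) := by
    refine cellAverage_mem hh (convex_closedBall _ _) Metric.isClosed_closedBall fun x hx => ?_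
    refine Metric.mem_closedBall.2 (hc x ?_).le
    rw [dist_eq_norm]
    exact (norm_sub_le_of_mem_cell hx (mem_cell_iff.2 rfl)).trans_lt (hN n hn.le)
  exact (Metric.mem_closedBall.1 h2).trans_lt (by linarith)

/-- The indices of the cells of side length `1 / (n + 1)` in a large cube. -/
def cellRange (d n : ℕ) : Finset (Fin d → ℤ) :=
  -- With mesh `1 / (n + 1)`, indices up to `(n + 1)²` reach coordinates of size `n + 1`, so the
  -- cells exhaust space while they shrink.
  Finset.Icc (fun _ => -((n : ℤ) + 1) ^ 2) fun _ => ((n : ℤ) + 1) ^ 2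

lemma eventually_cellIndex_mem (y : Space d) :
    ∀ᶠ n in atTop, cellIndex n y ∈ cellRange d n := by
  obtain ⟨N, hN⟩ := exists_nat_ge ‖y‖
  filter_upwards [eventually_ge_atTop N] with n hn
  have hn' : (N : ℝ) ≤ n := by exact_mod_cast hn
  have hb : ∀ l, |y l| ≤ n + 1 := fun l => by
    have : |y l| ≤ ‖y‖ := by simpa using PiLp.norm_apply_le y l
    linarith
  refine Finset.mem_Icc.2 ⟨fun l => ?_, fun l => ?_⟩
  · refine Int.le_floor.2 ?_
    push_cast
    nlinarith [(abs_le.1 (hb l)).1, Nat.cast_nonneg (α := ℝ) n]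
  · refine Int.floor_le_iff.2 ?_
    push_cast
    nlinarith [(abs_le.1 (hb l)).2, Nat.cast_nonneg (α := ℝ) n]

/-- The step function approximation of a function by its averages over cells. -/
def stepApprox (n : ℕ) (h : Space d → ℝ) (y : Space d) : ℝ :=
  ∑ j ∈ cellRange d n, cellAverage n j h * (cell n j).indicator 1 y

lemma stepApprox_eq_ite (n : ℕ) (h : Space d → ℝ) (y : Space d) :
    stepApprox n h y =
      if cellIndex n y ∈ cellRange d n then cellAverage n (cellIndex n y) h else 0 := by
  have hc : ∀ j, y ∈ cell n j ↔ cellIndex n y = j := fun j => mem_cell_iff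
  have : ∀ j, cellAverage n j h * (cell n j).indicator 1 y =
      if cellIndex n y = j then cellAverage n j h else 0 := fun j => by
    classical
    simp [Set.indicator_apply, hc]
  simp only [stepApprox, this, Finset.sum_ite_eq]

lemma tendsto_stepApprox {h : Space d → ℝ} (hh : Continuous h) (y : Space d) :
    Tendsto (fun n => stepApprox n h y) atTop (𝓝 (h y)) := by
  refine (tendsto_cellAverage hh y).congr' ?_
  filter_upwards [eventually_cellIndex_mem y] with n hn
  rw [stepApprox_eq_ite, if_pos hn]

/-- The factor that compares the weights of two points of the same cell. -/
def weightRatio (d : ℕ) : ℝ := (2 + 2 * (d : ℝ) ^ 2) ^ (((d : ℝ) + 1) / 2)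

lemma weight_le_of_mem_cell {n : ℕ} {j : Fin d → ℤ} {x y : Space d} (hx : x ∈ cell n j)
    (hy : y ∈ cell n j) : weight x ≤ weightRatio d * weight y := by
  refine weight_le_mul_weight (by positivity) ?_
  have h1 : ‖y‖ ≤ ‖x‖ + d := by
    have := norm_add_le x (y - x)
    rw [add_sub_cancel] at this
    linarith [norm_sub_le_dim_of_mem_cell hy hx]
  have h2 : ‖y‖ ^ 2 ≤ (‖x‖ + d) ^ 2 := pow_le_pow_left₀ (norm_nonneg y) h1 2
  -- `1 + (‖x‖ + d)² ≤ 1 + 2 ‖x‖² + 2 d² ≤ (2 + 2 d²) (1 + ‖x‖²)`.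
  nlinarith [sq_nonneg (‖x‖ - d), mul_nonneg (sq_nonneg (d : ℝ)) (sq_nonneg ‖x‖)]

lemma abs_stepApprox_le {h : Space d → ℝ} (hh : Continuous h) {B : ℝ}
    (hB : ∀ y, |h y| ≤ B * weight y) (n : ℕ) (y : Space d) :
    |stepApprox n h y| ≤ B * weightRatio d * weight y := by
  have hB0 : 0 ≤ B := by
    have := (abs_nonneg _).trans (hB 0)
    exact nonneg_of_mul_nonneg_left this (weight_pos _)
  have hR : 0 ≤ weightRatio d := Real.rpow_nonneg (by positivity) _
  rw [stepApprox_eq_ite]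
  split_ifs
  · have h2 : cellAverage n (cellIndex n y) h ∈
        Metric.closedBall (0 : ℝ) (B * weightRatio d * weight y) := by
      refine cellAverage_mem hh (convex_closedBall _ _) Metric.isClosed_closedBall fun x hx => ?_
      rw [mem_closedBall_zero_iff, Real.norm_eq_abs, mul_assoc]
      exact (hB x).trans
        (mul_le_mul_of_nonneg_left (weight_le_of_mem_cell hx (mem_cell_iff.2 rfl)) hB0)
    simpa using h2
  · rw [abs_zero]
    have := (weight_pos y).le
    positivity

lemma Config.pair_stepApprox (η : Config d C) (n : ℕ) (h : Space d → ℝ) :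
    η.pair (stepApprox n h) = ∑ j ∈ cellRange d n, cellAverage n j h * cellCharge n j η :=
  η.pair_sum_indicator n _ fun j => cellAverage n j h

lemma Config.tendsto_pair_stepApprox (η : Config d C) {h : Space d → ℝ} (hh : Continuous h)
    {B : ℝ} (hB : ∀ y, |h y| ≤ B * weight y) :
    Tendsto (fun n => η.pair (stepApprox n h)) atTop (𝓝 (η.pair h)) :=
  η.tendsto_pair (abs_stepApprox_le hh hB) (tendsto_stepApprox hh)

/-- In a fine mesh, the cell around an atom contains no other atom. -/
lemma Config.eventually_cellCharge_eq (η : Config d C) (y : Space d) :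
    ∀ᶠ n in atTop, (∀ x, η.charge x ≠ 0 → cellIndex n x = cellIndex n y → x = y) ∧
      cellCharge n (cellIndex n y) η = η.charge y := by
  -- A cell containing `y` has diameter at most `d` for every `n`, so only the finitely many atoms
  -- in this ball can share it with `y`.
  have hfin := η.finite_on_compact _ (isCompact_closedBall y d)
  have h1 : ∀ᶠ n : ℕ in atTop, ∀ x ∈ Metric.closedBall y (d : ℝ) ∩ Function.support η.charge,
      x ≠ y → (d : ℝ) / (n + 1) < ‖x - y‖ := by
    refine (eventually_all_finite hfin).2 fun x _ => ?_
    by_cases hxy : x = y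
    · exact Eventually.of_forall fun _ h => absurd hxy h
    · filter_upwards [(tendsto_order.1 (tendsto_mesh (d := d))).2 ‖x - y‖
        (norm_pos_iff.2 (sub_ne_zero.2 hxy))] with n hn _
      exact hn
  filter_upwards [h1] with n hn
  have h2 : ∀ x, η.charge x ≠ 0 → cellIndex n x = cellIndex n y → x = y := by
    intro x hx hxy
    by_contra hne
    have hx' : x ∈ cell n (cellIndex n y) := mem_cell_iff.2 hxy
    have hy' : y ∈ cell n (cellIndex n y) := mem_cell_iff.2 rfl
    have := hn x ⟨by
      rw [Metric.mem_closedBall, dist_eq_norm]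
      exact norm_sub_le_dim_of_mem_cell hx' hy', hx⟩ hne
    exact absurd (norm_sub_le_of_mem_cell hx' hy') (not_le.2 this)
  refine ⟨h2, ?_⟩
  rw [cellCharge, pair, tsum_eq_single y]
  · rw [Set.indicator_of_mem (mem_cell_iff.2 rfl), Pi.one_apply, mul_one]
  · intro x hx
    by_cases hx0 : η.charge x = 0
    · rw [hx0, zero_mul]
    · rw [Set.indicator_of_notMem (fun h => hx (h2 x hx0 (mem_cell_iff.1 h))), mul_zero]

/-- A discretisation of `⟨|η|, k⟩`. -/
def absCellSum (n : ℕ) (k : Space d → ℝ) (η : Config d C) : ℝ :=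
  ∑ j ∈ cellRange d n, cellAverage n j k * |cellCharge n j η|

lemma measurable_absCellSum (n : ℕ) (k : Space d → ℝ) :
    Measurable (absCellSum (C := C) n k) :=
  Finset.measurable_fun_sum _ fun j _ => (measurable_cellCharge n j).abs.const_mul _

/-- Once the mesh is fine, the charged points of `S` sit in distinct cells and each cell charge
equals the charge of its point, so no cancellation occurs. The other cells contribute nonnegative
terms; this one-sided bound is all that Fatou needs. -/
lemma Config.eventually_sum_le_absCellSum (η : Config d C) {k : Space d → ℝ} (hk : ∀ y, 0 ≤ k y)
    (S : Finset (Space d)) :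
    ∀ᶠ n in atTop, ∑ y ∈ S, |η.charge y| * cellAverage n (cellIndex n y) k ≤
      absCellSum n k η := by
  classical
  have h1 := (eventually_all_finset S).2 fun y _ =>
    (η.eventually_cellCharge_eq y).and (eventually_cellIndex_mem y)
  filter_upwards [h1] with n hn
  rw [← Finset.sum_filter_of_ne (p := fun y => η.charge y ≠ 0) fun y _ h h0 =>
    h (by rw [h0, abs_zero, zero_mul])]
  have hinj : Set.InjOn (cellIndex n) ((S.filter fun y => η.charge y ≠ 0 : Finset (Space d)) :
      Set (Space d)) := by
    intro x hx y hy hxy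
    rw [Finset.mem_coe, Finset.mem_filter] at hx hy
    exact (hn y hy.1).1.1 x hx.2 hxy
  calc ∑ y ∈ S with η.charge y ≠ 0, |η.charge y| * cellAverage n (cellIndex n y) k
      = ∑ y ∈ S with η.charge y ≠ 0,
          cellAverage n (cellIndex n y) k * |cellCharge n (cellIndex n y) η| := by
        refine Finset.sum_congr rfl fun y hy => ?_
        rw [(hn y (Finset.mem_filter.1 hy).1).1.2, mul_comm]
    _ = ∑ j ∈ (S.filter fun y => η.charge y ≠ 0).image (cellIndex n),
          cellAverage n j k * |cellCharge n j η| := (Finset.sum_image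
          (f := fun j => cellAverage n j k * |cellCharge n j η|) hinj).symm
    _ ≤ absCellSum n k η := by
        refine Finset.sum_le_sum_of_subset_of_nonneg (fun j hj => ?_) fun j _ _ =>
          mul_nonneg (cellAverage_nonneg hk n j) (abs_nonneg _)
        obtain ⟨y, hy, rfl⟩ := Finset.mem_image.1 hj
        exact (hn y (Finset.mem_filter.1 hy).1).2

/-! ### Exponential moments of the total variation of a configuration. -/

section Campbell

variable {z : ℝ} {r : Measure ℝ} [IsProbabilityMeasure r] {μ₀ : Measure (Config d C)}

/-- Independence factors the integral over the cells, and each factor is a compound Poisson moment.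
-/
lemma IsFreeGas.lintegral_exp_sum_le (hz : 0 ≤ z) (hrC : r (Set.Icc (-C) C)ᶜ = 0)
    (hμ₀ : IsFreeGas z r μ₀) (n : ℕ) (J : Finset (Fin d → ℤ)) {a : (Fin d → ℤ) → ℝ}
    (ha : ∀ j, 0 ≤ a j) :
    ∫⁻ η, ENNReal.ofReal (Real.exp (∑ j ∈ J, a j * |cellCharge n j η|)) ∂μ₀ ≤
      ENNReal.ofReal (Real.exp
        (z * ∑ j ∈ J, volume.real (cell n j) * (Real.exp (a j * C) - 1))) := by
  have hX : Measurable (fun η (j : J) => cellCharge (C := C) n j.1 η) :=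
    measurable_pi_lambda _ fun j => measurable_cellCharge n j.1
  have hl : ∀ j : J, 0 ≤ z * volume.real (cell n j.1) := fun j => by positivity
  have := fun j : J => isProbabilityMeasure_compoundPoisson (r := r) (hl j)
  have hsum : ∀ η : Config d C, ∑ j ∈ J, a j * |cellCharge n j η| =
      ∑ j : J, a j.1 * |cellCharge n j.1 η| := fun η => (Finset.sum_coe_sort J _).symm
  calc ∫⁻ η, ENNReal.ofReal (Real.exp (∑ j ∈ J, a j * |cellCharge n j η|)) ∂μ₀
      = ∫⁻ x : J → ℝ, ∏ j, ENNReal.ofReal (Real.exp (a j.1 * |x j|))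
          ∂μ₀.map (fun η (j : J) => cellCharge n j.1 η) := by
        rw [lintegral_map (by fun_prop) hX]
        refine lintegral_congr fun η => ?_
        rw [hsum, Real.exp_sum, ENNReal.ofReal_prod_of_nonneg fun _ _ => Real.exp_nonneg _]
    _ = ∏ j : J, ∫⁻ t, ENNReal.ofReal (Real.exp (a j.1 * |t|))
          ∂compoundPoisson (z * volume.real (cell n j.1)) r := by
        rw [hμ₀.map_cellCharge hz hrC n J]
        rw [ProbabilityTheory.lintegral_prod_eq_prod_lintegral_of_indepFun Finset.univ
          (fun (j : J) (x : J → ℝ) => ENNReal.ofReal (Real.exp (a j.1 * |x j|)))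
          (ProbabilityTheory.iIndepFun_pi
            (X := fun (j : J) (t : ℝ) => ENNReal.ofReal (Real.exp (a j.1 * |t|)))
            fun j => by fun_prop) fun j => by fun_prop]
        refine Finset.prod_congr rfl fun j _ => ?_
        exact (measurePreserving_eval
          (fun j : J => compoundPoisson (z * volume.real (cell n j.1)) r) j).lintegral_comp
          (f := fun t : ℝ => ENNReal.ofReal (Real.exp (a j.1 * |t|))) (by fun_prop)
    _ ≤ ∏ j : J, ENNReal.ofReal (Real.exp
          (z * volume.real (cell n j.1) * (Real.exp (a j.1 * C) - 1))) :=
        Finset.prod_le_prod' fun j _ =>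
          lintegral_exp_abs_compoundPoisson_le hrC (ha j.1) (hl j)
    _ = _ := by
        rw [← ENNReal.ofReal_prod_of_nonneg fun _ _ => Real.exp_nonneg _, ← Real.exp_sum,
          Finset.sum_coe_sort J fun j =>
            z * volume.real (cell n j) * (Real.exp (a j * C) - 1), Finset.mul_sum]
        simp_rw [mul_assoc]

/-- The inequality `e^u - 1 ≤ u e^u`, with `u = C` times a cell average and hence `u ≤ M C`,
linearises the exponent. Volume times average is an integral over a cell, and these add up to at
most `∫ k`, uniformly in `n`. -/
lemma IsFreeGas.lintegral_exp_absCellSum_le (hz : 0 ≤ z) (hC : 0 ≤ C)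
    (hrC : r (Set.Icc (-C) C)ᶜ = 0)
    (hμ₀ : IsFreeGas z r μ₀) {k : Space d → ℝ} (hkc : Continuous k) (hk : ∀ y, 0 ≤ k y) {M : ℝ}
    (hM : ∀ y, k y ≤ M) (hki : Integrable k) (n : ℕ) :
    ∫⁻ η, ENNReal.ofReal (Real.exp (absCellSum n k η)) ∂μ₀ ≤
      ENNReal.ofReal (Real.exp (z * (C * Real.exp (M * C) * ∫ y, k y))) := by
  refine (hμ₀.lintegral_exp_sum_le hz hrC n (cellRange d n)
    fun j => cellAverage_nonneg hk n j).trans (ENNReal.ofReal_le_ofReal (Real.exp_le_exp.2 ?_))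
  refine mul_le_mul_of_nonneg_left ?_ hz
  have h1 : ∀ u : ℝ, Real.exp u - 1 ≤ u * Real.exp u := fun u => by
    have h := Real.add_one_le_exp (-u)
    have h' : Real.exp (-u) * Real.exp u = 1 := by rw [← Real.exp_add]; simp
    nlinarith [Real.exp_pos u]
  have h2 : ∀ j, cellAverage n j k ≤ M := fun j =>
    cellAverage_mem hkc (convex_Iic M) isClosed_Iic fun y _ => hM y
  calc ∑ j ∈ cellRange d n, volume.real (cell n j) * (Real.exp (cellAverage n j k * C) - 1)
      ≤ ∑ j ∈ cellRange d n, C * Real.exp (M * C) * ∫ y in cell n j, k y := by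
        refine Finset.sum_le_sum fun j _ => ?_
        have h0 := cellAverage_nonneg hk n j
        calc volume.real (cell n j) * (Real.exp (cellAverage n j k * C) - 1)
            ≤ volume.real (cell n j) * (cellAverage n j k * C * Real.exp (M * C)) := by
              refine mul_le_mul_of_nonneg_left ((h1 _).trans ?_) (by positivity)
              gcongr
              exact h2 j
          _ = C * Real.exp (M * C) * (volume.real (cell n j) * cellAverage n j k) := by ring
          _ = _ := by rw [volume_mul_cellAverage]
    _ = C * Real.exp (M * C) * ∫ y in ⋃ j ∈ cellRange d n, cell n j, k y := by
        rw [← Finset.mul_sum, integral_biUnion_finset _ (fun j _ => measurableSet_cell n j) ?_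
          fun j _ => hki.integrableOn]
        intro i _ j _ hij
        refine Set.disjoint_left.2 fun y hi hj => hij ?_
        rw [← mem_cell_iff.1 hi, ← mem_cell_iff.1 hj]
    _ ≤ C * Real.exp (M * C) * ∫ y, k y :=
        mul_le_mul_of_nonneg_left (setIntegral_le_integral hki (ae_of_all _ hk)) (by positivity)

/-- `exp ⟨|η|, k⟩` has an integrable majorant when `k` is continuous, bounded and integrable. -/
lemma IsFreeGas.exists_integrable_majorant (hz : 0 ≤ z) (hC : 0 ≤ C)
    (hrC : r (Set.Icc (-C) C)ᶜ = 0)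
    (hμ₀ : IsFreeGas z r μ₀) {k : Space d → ℝ} (hkc : Continuous k) (hk : ∀ y, 0 ≤ k y) {M : ℝ}
    (hM : ∀ y, k y ≤ M) (hki : Integrable k) :
    ∃ Z : Config d C → ℝ, Integrable Z μ₀ ∧ ∀ᵐ η ∂μ₀,
      Summable (fun y => |η.charge y| * k y) ∧ Real.exp (∑' y, |η.charge y| * k y) ≤ Z η := by
  -- Taking the liminf of the discretisations as majorant spares a proof that `η ↦ ⟨|η|, k⟩` is
  -- measurable; Fatou bounds its integral.
  set Z : Config d C → ℝ≥0∞ :=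
    fun η => liminf (fun n => ENNReal.ofReal (Real.exp (absCellSum n k η))) atTop with hZ
  have hmeas : ∀ n, Measurable fun η : Config d C =>
      ENNReal.ofReal (Real.exp (absCellSum n k η)) := fun n =>
    (measurable_absCellSum n k).exp.ennreal_ofReal
  have hZm : Measurable Z := Measurable.liminf hmeas
  have hZi : ∫⁻ η, Z η ∂μ₀ ≠ ∞ := by
    refine ne_top_of_le_ne_top (b := ENNReal.ofReal (Real.exp
      (z * (C * Real.exp (M * C) * ∫ y, k y)))) ENNReal.ofReal_ne_top ((lintegral_liminf_le hmeas).trans ?_)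
    refine (liminf_le_liminf (Eventually.of_forall
      (hμ₀.lintegral_exp_absCellSum_le hz hC hrC hkc hk hM hki))).trans ?_
    rw [liminf_const]
  refine ⟨fun η => (Z η).toReal, integrable_toReal_of_lintegral_ne_top hZm.aemeasurable hZi, ?_⟩
  filter_upwards [ae_lt_top hZm hZi] with η hη
  -- Bounding all finite partial sums by `log Z` gives summability and the bound on the sum at once,
  -- so `k` need not be dominated by the weight.
  have h1 : ∀ S : Finset (Space d),
      Real.exp (∑ y ∈ S, |η.charge y| * k y) ≤ (Z η).toReal := by
    intro S
    refine (ENNReal.ofReal_le_iff_le_toReal hη.ne).1 ?_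
    have h2 : Tendsto (fun n => ENNReal.ofReal (Real.exp
        (∑ y ∈ S, |η.charge y| * cellAverage n (cellIndex n y) k))) atTop
        (𝓝 (ENNReal.ofReal (Real.exp (∑ y ∈ S, |η.charge y| * k y)))) :=
      ENNReal.tendsto_ofReal ((Real.continuous_exp.tendsto _).comp
        (tendsto_finsetSum _ fun y _ => (tendsto_cellAverage hkc y).const_mul _))
    rw [← h2.liminf_eq]
    refine liminf_le_liminf ?_
    filter_upwards [η.eventually_sum_le_absCellSum hk S] with n hn
    exact ENNReal.ofReal_le_ofReal (Real.exp_le_exp.2 hn)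
  have h0 : 0 < (Z η).toReal := lt_of_lt_of_le (Real.exp_pos _) (h1 ∅)
  have h3 : ∀ S : Finset (Space d), ∑ y ∈ S, |η.charge y| * k y ≤ Real.log (Z η).toReal :=
    fun S => (Real.le_log_iff_exp_le h0).2 (h1 S)
  have hnn : (0 : Space d → ℝ) ≤ fun y => |η.charge y| * k y :=
    fun y => mul_nonneg (abs_nonneg _) (hk y)
  exact ⟨summable_of_sum_le hnn h3, (Real.le_log_iff_exp_le h0).1 (Real.tsum_le_of_sum_le hnn h3)⟩

end Campbell

end WeakAttraction

end

/-! ### Dominated limits, the potential, and the finite-dimensional correlation inequality. -/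

noncomputable section

namespace WeakAttraction

open scoped Topology ENNReal

/-- Convergence of the correlation inequality under exponential domination. -/
lemma correlation_le_of_tendsto {Ω : Type*} [MeasurableSpace Ω] {μ : Measure Ω}
    {F V W : ℕ → Ω → ℝ} {F' V' W' S Z : Ω → ℝ} {K : ℝ}
    (hF : ∀ n, AEStronglyMeasurable (F n) μ) (hV : ∀ n, AEStronglyMeasurable (V n) μ)
    (hW : ∀ n, AEStronglyMeasurable (W n) μ)
    (hFb : ∀ n, ∀ᵐ η ∂μ, |F n η| ≤ K * Real.exp (S η))
    (hVb : ∀ n, ∀ᵐ η ∂μ, |V n η| ≤ S η) (hWb : ∀ n, ∀ᵐ η ∂μ, |W n η| ≤ S η)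
    (hZ : Integrable Z μ) (hSZ : ∀ᵐ η ∂μ, Real.exp (2 * S η) ≤ Z η)
    (hFl : ∀ᵐ η ∂μ, Tendsto (fun n => F n η) atTop (𝓝 (F' η)))
    (hVl : ∀ᵐ η ∂μ, Tendsto (fun n => V n η) atTop (𝓝 (V' η)))
    (hWl : ∀ᵐ η ∂μ, Tendsto (fun n => W n η) atTop (𝓝 (W' η)))
    (h : ∀ n, (∫ η, F n η * Real.exp (-V n η) ∂μ) * ∫ η, Real.exp (-W n η) ∂μ ≤
      (∫ η, F n η * Real.exp (-W n η) ∂μ) * ∫ η, Real.exp (-V n η) ∂μ) :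
    (∫ η, F' η * Real.exp (-V' η) ∂μ) * ∫ η, Real.exp (-W' η) ∂μ ≤
      (∫ η, F' η * Real.exp (-W' η) ∂μ) * ∫ η, Real.exp (-V' η) ∂μ := by
  -- One argument serves `V` and `W`. Of the exponent `2 * S`, one `S` pays for the observable and
  -- one for the Boltzmann factor.
  have key : ∀ V : ℕ → Ω → ℝ, ∀ V' : Ω → ℝ, (∀ n, AEStronglyMeasurable (V n) μ) →
      (∀ n, ∀ᵐ η ∂μ, |V n η| ≤ S η) →
      (∀ᵐ η ∂μ, Tendsto (fun n => V n η) atTop (𝓝 (V' η))) →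
      Tendsto (fun n => ∫ η, F n η * Real.exp (-V n η) ∂μ) atTop
        (𝓝 (∫ η, F' η * Real.exp (-V' η) ∂μ)) ∧
      Tendsto (fun n => ∫ η, Real.exp (-V n η) ∂μ) atTop (𝓝 (∫ η, Real.exp (-V' η) ∂μ)) := by
    intro V V' hV hVb hVl
    have hVe : ∀ n, AEStronglyMeasurable (fun η => Real.exp (-V n η)) μ := fun n =>
      Real.continuous_exp.comp_aestronglyMeasurable (hV n).neg
    constructor
    · refine tendsto_integral_of_dominated_convergence (fun η => K * Z η)
        (fun n => (hF n).mul (hVe n)) (hZ.const_mul K) (fun n => ?_) ?_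
      · filter_upwards [hFb n, hVb n, hSZ] with η h1 h2 h3
        rw [norm_mul, Real.norm_eq_abs, Real.norm_of_nonneg (Real.exp_nonneg _)]
        have hK : 0 ≤ K := nonneg_of_mul_nonneg_left ((abs_nonneg _).trans h1) (Real.exp_pos _)
        calc |F n η| * Real.exp (-V n η)
            ≤ K * Real.exp (S η) * Real.exp (S η) := by
              gcongr
              linarith [(abs_le.1 h2).1]
          _ = K * Real.exp (2 * S η) := by rw [mul_assoc, ← Real.exp_add, two_mul]
          _ ≤ K * Z η := by gcongr
      · filter_upwards [hFl, hVl] with η h1 h2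
        exact h1.mul ((Real.continuous_exp.tendsto _).comp h2.neg)
    · refine tendsto_integral_of_dominated_convergence Z hVe hZ (fun n => ?_) ?_
      · filter_upwards [hVb n, hSZ] with η h2 h3
        rw [Real.norm_of_nonneg (Real.exp_nonneg _)]
        refine le_trans (Real.exp_le_exp.2 ?_) h3
        linarith [(abs_le.1 h2).1, (abs_nonneg _).trans h2]
      · filter_upwards [hVl] with η h2
        exact (Real.continuous_exp.tendsto _).comp h2.neg
  obtain ⟨h1, h2⟩ := key V V' hV hVb hVl
  obtain ⟨h3, h4⟩ := key W W' hW hWb hWl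
  exact le_of_tendsto_of_tendsto' (h1.mul h4) (h3.mul h2) h

/-- The properties of the interaction potential: a Lipschitz, concave, decreasing function that
vanishes at the origin. -/
structure IsAttractive (v : ℝ → ℝ) (b : ℝ) : Prop where
  zero : v 0 = 0
  lipschitz : ∀ s t, |v s - v t| ≤ b * |s - t|
  concave : ConcaveOn ℝ Set.univ v
  antitone : Antitone v

namespace IsAttractive

variable {v : ℝ → ℝ} {b : ℝ}

lemma nonneg (hv : IsAttractive v b) : 0 ≤ b := by
  have := (abs_nonneg _).trans (hv.lipschitz 1 0)
  simpa using this

lemma continuous (hv : IsAttractive v b) : Continuous v := by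
  refine (LipschitzWith.of_dist_le_mul (K := ⟨b, hv.nonneg⟩) fun s t => ?_).continuous
  rw [Real.dist_eq, Real.dist_eq]
  exact hv.lipschitz s t

lemma abs_le (hv : IsAttractive v b) (t : ℝ) : |v t| ≤ b * |t| := by
  simpa [hv.zero] using hv.lipschitz t 0

/-- With equal sums, `p` and `q` lie between `t` and `s`: they are `θ s + (1 - θ) t` and `(1 - θ) s
+ θ t` for the same `θ`. Adding the two concavity inequalities eliminates `θ`. -/
lemma add_le_add (hv : IsAttractive v b) {p q s t : ℝ} (hsum : p + q = s + t) (hp : p ≤ s)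
    (hq : q ≤ s) : v s + v t ≤ v p + v q := by
  rcases eq_or_ne s t with rfl | hne
  · have hp' : p = s := by linarith
    have hq' : q = s := by linarith
    rw [hp', hq']
  have hst : 0 < s - t := by
    rcases lt_or_gt_of_ne hne with h | h <;> linarith
  set θ := (p - t) / (s - t) with hθ
  have h0 : 0 ≤ θ := div_nonneg (by linarith) hst.le
  have h1 : 0 ≤ 1 - θ := by
    rw [hθ, sub_nonneg, div_le_one hst]; linarith
  have hθm : θ * (s - t) = p - t := div_mul_cancel₀ _ hst.ne'
  have e1 := hv.concave.2 (Set.mem_univ s) (Set.mem_univ t) h0 h1 (by ring)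
  have e2 := hv.concave.2 (Set.mem_univ s) (Set.mem_univ t) h1 h0 (by ring)
  simp only [smul_eq_mul] at e1 e2
  rw [show θ * s + (1 - θ) * t = p by linarith] at e1
  rw [show (1 - θ) * s + θ * t = q by linarith] at e2
  linarith

/-- Right side minus left side is `g₁ (v p + v q - v s - v t) + (g₂ - g₁) (v q - v s)`: concavity
settles the first term, monotonicity the second. -/
lemma mul_add_mul_le (hv : IsAttractive v b) {p q s t g₁ g₂ : ℝ} (hsum : p + q = s + t)
    (hp : p ≤ s) (hq : q ≤ s) (hg₁ : 0 ≤ g₁) (hg : g₁ ≤ g₂) :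
    v s * g₂ + v t * g₁ ≤ v p * g₁ + v q * g₂ := by
  nlinarith [mul_nonneg hg₁ (sub_nonneg.2 (hv.add_le_add hsum hp hq)),
    mul_nonneg (sub_nonneg.2 hg) (sub_nonneg.2 (hv.antitone hq))]

end IsAttractive

lemma measurable_integral_linear {E ι : Type*} [TopologicalSpace E] [SecondCountableTopology E]
    [MeasurableSpace E] [OpensMeasurableSpace E] {m : Measure E} [SFinite m] [Fintype ι]
    {v : ℝ → ℝ} (hv : Continuous v) {a : ι → E → ℝ} (ha : ∀ j, Continuous (a j)) {g : E → ℝ}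
    (hg : Continuous g) :
    Measurable fun ξ : ι → ℝ => ∫ x, v (∑ j, a j x * ξ j) * g x ∂m := by
  have hc : Continuous fun p : (ι → ℝ) × E => v (∑ j, a j p.2 * p.1 j) * g p.2 := by fun_prop
  exact (hc.stronglyMeasurable.integral_prod_right' (ν := m)).measurable

/-- The correlation inequality for finitely many independent variables. -/
lemma lintegral_correlation_le {E ι : Type*} [TopologicalSpace E] [SecondCountableTopology E]
    [MeasurableSpace E] [OpensMeasurableSpace E] {m : Measure E} [SFinite m]
    [IsFiniteMeasureOnCompacts m]
    [Fintype ι] {ν : ι → Measure ℝ} [∀ i, SigmaFinite (ν i)]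
    {v : ℝ → ℝ} {b : ℝ} (hv : IsAttractive v b) {a : ι → E → ℝ} (ha : ∀ j, Continuous (a j))
    (ha0 : ∀ j x, 0 ≤ a j x) {g₁ g₂ : E → ℝ} (hg₁c : Continuous g₁)
    (hg₁s : HasCompactSupport g₁) (hg₂c : Continuous g₂) (hg₂s : HasCompactSupport g₂)
    (hg₁ : ∀ x, 0 ≤ g₁ x) (hg : ∀ x, g₁ x ≤ g₂ x) {N : (ι → ℝ) → ℝ} (hN : Measurable N)
    (hNm : Monotone N) (hN0 : ∀ ξ, 0 ≤ N ξ) {Φ : (E → ℝ) → (ι → ℝ) → ℝ}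
    (hΦ : ∀ g ξ, Φ g ξ = ∫ x, v (∑ j, a j x * ξ j) * g x ∂m) :
    (∫⁻ ξ, ENNReal.ofReal (N ξ * Real.exp (-Φ g₁ ξ)) ∂Measure.pi ν) *
        ∫⁻ ξ, ENNReal.ofReal (Real.exp (-Φ g₂ ξ)) ∂Measure.pi ν ≤
      (∫⁻ ξ, ENNReal.ofReal (N ξ * Real.exp (-Φ g₂ ξ)) ∂Measure.pi ν) *
        ∫⁻ ξ, ENNReal.ofReal (Real.exp (-Φ g₁ ξ)) ∂Measure.pi ν := by
  have hvc := hv.continuous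
  have hm₁ : Measurable (Φ g₁) := by
    rw [funext (hΦ g₁)]; exact measurable_integral_linear hvc ha hg₁c
  have hm₂ : Measurable (Φ g₂) := by
    rw [funext (hΦ g₂)]; exact measurable_integral_linear hvc ha hg₂c
  -- On the right, the observable and the larger cut-off `g₂` are evaluated at the join, the smaller
  -- cut-off `g₁` at the meet.
  refine lintegral_four_functions_pi (by fun_prop) (by fun_prop) (by fun_prop) (by fun_prop)
    fun ξ ζ => ?_
  rw [← ENNReal.ofReal_mul (mul_nonneg (hN0 _) (Real.exp_nonneg _)),
    ← ENNReal.ofReal_mul (mul_nonneg (hN0 _) (Real.exp_nonneg _))]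
  refine ENNReal.ofReal_le_ofReal ?_
  rw [mul_assoc, mul_assoc, ← Real.exp_add, ← Real.exp_add]
  have hint : ∀ (g : E → ℝ) (ξ : ι → ℝ), Continuous g → HasCompactSupport g →
      Integrable (fun x => v (∑ j, a j x * ξ j) * g x) m := fun g ξ hgc hgs =>
    Continuous.integrable_of_hasCompactSupport (by fun_prop) hgs.mul_left
  refine mul_le_mul (hNm le_sup_left) (Real.exp_le_exp.2 ?_) (Real.exp_nonneg _) (hN0 _)
  have : Φ g₂ (ξ ⊔ ζ) + Φ g₁ (ξ ⊓ ζ) ≤ Φ g₁ ξ + Φ g₂ ζ := by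
    rw [hΦ, hΦ, hΦ, hΦ, ← integral_add (hint _ _ hg₂c hg₂s) (hint _ _ hg₁c hg₁s),
      ← integral_add (hint _ _ hg₁c hg₁s) (hint _ _ hg₂c hg₂s)]
    refine integral_mono ((hint _ _ hg₂c hg₂s).add (hint _ _ hg₁c hg₁s))
      ((hint _ _ hg₁c hg₁s).add (hint _ _ hg₂c hg₂s)) fun x => ?_
    -- The sum condition is linearity together with `max + min = sum` in each coordinate; the two
    -- bounds use that the coefficients `a j x` are nonnegative.
    refine hv.mul_add_mul_le ?_ ?_ ?_ (hg₁ x) (hg x)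
    · rw [← Finset.sum_add_distrib, ← Finset.sum_add_distrib]
      refine Finset.sum_congr rfl fun j _ => ?_
      rw [← mul_add, ← mul_add, Pi.sup_apply, Pi.inf_apply, max_add_min]
    · exact Finset.sum_le_sum fun j _ => mul_le_mul_of_nonneg_left le_sup_left (ha0 j x)
    · exact Finset.sum_le_sum fun j _ => mul_le_mul_of_nonneg_left le_sup_right (ha0 j x)
  linarith

variable {d : ℕ} {C : ℝ}

lemma Config.abs_pair_le (η : Config d C) {k : Space d → ℝ} {B : ℝ}
    (h : ∀ y, |k y| ≤ B * weight y) :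
    |η.pair k| ≤ B * ∑' y, |η.charge y| * weight y := by
  rw [← tsum_mul_left, ← Real.norm_eq_abs]
  refine tsum_of_norm_bounded (η.summable_abs_mul_weight.mul_left B).hasSum fun y => ?_
  rw [Real.norm_eq_abs, abs_mul]
  nlinarith [h y, abs_nonneg (η.charge y)]

/-- Test functions of observables are merely continuous, so measurability is not immediate from the
sigma algebra; it is inherited from the cell charges through step approximation. -/
lemma measurable_pair {h : Space d → ℝ} (hh : Continuous h) {B : ℝ}
    (hB : ∀ y, |h y| ≤ B * weight y) : Measurable fun η : Config d C => η.pair h := by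
  refine measurable_of_tendsto_metrizable (f := fun n η => η.pair (stepApprox n h)) (fun n => ?_)
    (tendsto_pi_nhds.2 fun η => η.tendsto_pair_stepApprox hh hB)
  simp_rw [Config.pair_stepApprox]
  exact Finset.measurable_fun_sum _ fun j _ => (measurable_cellCharge n j).const_mul _

/-- The interaction with the discretised field. -/
def stepInteraction (n : ℕ) (G : Space d → ℝ) (v : ℝ → ℝ) (g : Space d → ℝ)
    (η : Config d C) : ℝ :=
  ∫ x, v (η.pair (stepApprox n fun y => G (x - y))) * g x

lemma stepInteraction_eq (n : ℕ) (G : Space d → ℝ) (v : ℝ → ℝ) (g : Space d → ℝ)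
    (η : Config d C) : stepInteraction n G v g η =
      ∫ x, v (∑ j : cellRange d n, cellAverage n j.1 (fun y => G (x - y)) *
        cellCharge n j.1 η) * g x := by
  unfold stepInteraction
  congr 1
  ext x
  rw [Config.pair_stepApprox, Finset.sum_coe_sort (cellRange d n) fun j => cellAverage n j (fun y => G (x - y)) *
        cellCharge n j η]

lemma continuous_cellAverage {G : Space d → ℝ} (hG : Continuous G) (hGs : HasCompactSupport G)
    (n : ℕ) (j : Fin d → ℤ) : Continuous fun x => cellAverage n j fun y => G (x - y) := by
  obtain ⟨M, hM⟩ := hGs.exists_bound_of_continuous hG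
  simp_rw [cellAverage, setAverage_eq]
  refine continuous_const.mul ?_
  refine continuous_of_dominated (F := fun x y => G (x - y)) (bound := fun _ => M) (fun x => ?_)
    (fun x => ae_of_all _ fun y => hM _) (integrableOn_const (volume_cell_lt_top n j).ne)
    (ae_of_all _ fun y => by fun_prop)
  exact Continuous.aestronglyMeasurable (by fun_prop)

/-! ### Interactions with a continuous, compactly supported kernel. -/

section Smooth

variable {G : Space d → ℝ} {v : ℝ → ℝ} {b : ℝ} {g : Space d → ℝ}

lemma measurable_stepInteraction (n : ℕ) (hG : Continuous G) (hGs : HasCompactSupport G)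
    (hv : IsAttractive v b) (hg : Continuous g) :
    Measurable (stepInteraction (C := C) n G v g) := by
  have h1 : Measurable fun ξ : cellRange d n → ℝ =>
      ∫ x, v (∑ j : cellRange d n, cellAverage n j.1 (fun y => G (x - y)) * ξ j) * g x :=
    measurable_integral_linear (m := volume) (v := v) (g := g)
      (a := fun (j : cellRange d n) x => cellAverage n j.1 fun y => G (x - y)) hv.continuous
      (fun j => continuous_cellAverage hG hGs n j.1) hg
  have hX : Measurable (fun η (j : cellRange d n) => cellCharge (C := C) n j.1 η) :=
    measurable_pi_lambda _ fun j => measurable_cellCharge n j.1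
  rw [funext (stepInteraction_eq n G v g)]
  exact h1.comp hX

/-- For `x` in the support of `g`, all the translates of `G` live in one ball, which makes the
constant uniform in `x`. -/
lemma exists_translate_le_weight (hG : Continuous G) (hGs : HasCompactSupport G)
    (hgs : HasCompactSupport g) :
    ∃ B, 0 ≤ B ∧ ∀ x, g x ≠ 0 → ∀ y, |G (x - y)| ≤ B * weight y := by
  obtain ⟨M, hM⟩ := hGs.exists_bound_of_continuous hG
  obtain ⟨R₁, hR₁⟩ := hGs.isCompact.isBounded.subset_closedBall 0
  obtain ⟨R₂, hR₂⟩ := hgs.isCompact.isBounded.subset_closedBall 0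
  have hM0 : 0 ≤ M := (norm_nonneg _).trans (hM 0)
  refine ⟨M * (1 + (R₁ + R₂) ^ 2) ^ (((d : ℝ) + 1) / 2), by positivity, fun x hx y => ?_⟩
  by_cases hy : G (x - y) = 0
  · rw [hy, abs_zero]
    have := (weight_pos y).le
    positivity
  · have h1 := mem_closedBall_zero_iff.1 (hR₁ (subset_tsupport _ hy))
    have h2 := mem_closedBall_zero_iff.1 (hR₂ (subset_tsupport _ hx))
    have h3 : ‖y‖ ≤ R₁ + R₂ := by
      have := norm_sub_le x (x - y)
      rw [sub_sub_cancel] at this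
      linarith
    rw [mul_assoc]
    exact (hM _).trans (le_mul_of_one_le_right hM0 (one_le_mul_weight h3))

lemma norm_mul_le_of_abs_le (hv : IsAttractive v b) (hg0 : ∀ x, 0 ≤ g x)
    {p : Space d → ℝ} {T : ℝ} (hp : ∀ x, g x ≠ 0 → |p x| ≤ T) (x : Space d) :
    ‖v (p x) * g x‖ ≤ b * T * g x := by
  rw [norm_mul, Real.norm_eq_abs, Real.norm_of_nonneg (hg0 x)]
  by_cases hx : g x = 0
  · simp [hx]
  · exact mul_le_mul_of_nonneg_right ((hv.abs_le _).trans
      (mul_le_mul_of_nonneg_left (hp x hx) hv.nonneg)) (hg0 x)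

lemma abs_stepInteraction_le (hv : IsAttractive v b) (hG : Continuous G) (hg : Integrable g)
    (hg0 : ∀ x, 0 ≤ g x) {B : ℝ} (hB : ∀ x, g x ≠ 0 → ∀ y, |G (x - y)| ≤ B * weight y)
    (n : ℕ) (η : Config d C) :
    |stepInteraction n G v g η| ≤
      b * (B * weightRatio d * ∑' y, |η.charge y| * weight y) * ∫ x, g x := by
  rw [← integral_const_mul, ← Real.norm_eq_abs]
  refine norm_integral_le_of_norm_le (hg.const_mul _) (ae_of_all _ fun x => ?_)
  exact norm_mul_le_of_abs_le hv hg0 (p := fun x => η.pair (stepApprox n fun y => G (x - y)))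
    (fun x hx => η.abs_pair_le (abs_stepApprox_le (by fun_prop) (hB x hx) n)) x

lemma tendsto_stepInteraction (hv : IsAttractive v b) (hG : Continuous G)
    (hGs : HasCompactSupport G) (hgc : Continuous g) (hg : Integrable g)
    (hg0 : ∀ x, 0 ≤ g x) {B : ℝ} (hB : ∀ x, g x ≠ 0 → ∀ y, |G (x - y)| ≤ B * weight y)
    (η : Config d C) :
    Tendsto (fun n => stepInteraction n G v g η) atTop (𝓝 (interaction G v g η)) := by
  refine tendsto_integral_of_dominated_convergence
    (fun x => b * (B * weightRatio d * ∑' y, |η.charge y| * weight y) * g x) (fun n => ?_)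
    (hg.const_mul _) (fun n => ae_of_all _ fun x => ?_) (ae_of_all _ fun x => ?_)
  · simp_rw [Config.pair_stepApprox]
    have := hv.continuous
    have := continuous_cellAverage hG hGs n
    exact Continuous.aestronglyMeasurable (by fun_prop)
  · exact norm_mul_le_of_abs_le hv hg0
      (p := fun x => η.pair (stepApprox n fun y => G (x - y)))
      (fun x hx => η.abs_pair_le (abs_stepApprox_le (by fun_prop) (hB x hx) n)) x
  · by_cases hx : g x = 0
    · simp [hx]
    · exact ((hv.continuous.tendsto _).comp
        (η.tendsto_pair_stepApprox (by fun_prop) (hB x hx))).mul_const _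

lemma measurable_interaction (hv : IsAttractive v b) (hG : Continuous G)
    (hGs : HasCompactSupport G) (hgc : Continuous g) (hgs : HasCompactSupport g)
    (hg0 : ∀ x, 0 ≤ g x) : Measurable (interaction (C := C) G v g) := by
  obtain ⟨B, -, hB⟩ := exists_translate_le_weight hG hGs hgs
  exact measurable_of_tendsto_metrizable
    (fun n => measurable_stepInteraction n hG hGs hv hgc)
    (tendsto_pi_nhds.2 fun η => tendsto_stepInteraction hv hG hGs hgc
      (hgc.integrable_of_hasCompactSupport hgs) hg0 hB η)

end Smooth

/-! ### The correlation inequality for continuous kernels. -/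

/-- The regularity and growth conditions on an observable `η ↦ H (⟨η, h₁⟩, …, ⟨η, h_n⟩)`. -/
structure IsTameObservable {n : ℕ} (H : (Fin n → ℝ) → ℝ) (h : Fin n → Space d → ℝ)
    (K κ B : ℝ) : Prop where
  cont : Continuous H
  κ_nonneg : 0 ≤ κ
  K_nonneg : 0 ≤ K
  le_exp : ∀ x, |H x| ≤ K * Real.exp (κ * ∑ i, |x i|)
  cont_test : ∀ l, Continuous (h l)
  test_le : ∀ l y, |h l y| ≤ B * weight y

/-- The conditions for `η ↦ H (⟨η, h₁⟩, …, ⟨η, h_n⟩)` to be a nonnegative increasing observable. -/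
structure IsNonnegIncreasing {n : ℕ} (H : (Fin n → ℝ) → ℝ) (h : Fin n → Space d → ℝ)
    (K κ B : ℝ) : Prop extends IsTameObservable H h K κ B where
  mono : Monotone H
  nonneg : ∀ x, 0 ≤ H x
  test_nonneg : ∀ l y, 0 ≤ h l y

section Correlation

variable {z : ℝ} {r : Measure ℝ} [IsProbabilityMeasure r] {μ₀ : Measure (Config d C)}
  {v : ℝ → ℝ} {b : ℝ} {g₁ g₂ : Space d → ℝ} {N : ℕ} {H : (Fin N → ℝ) → ℝ}
  {h : Fin N → Space d → ℝ} {K κ A : ℝ} {G : Space d → ℝ}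

lemma IsTameObservable.abs_le (hH : IsTameObservable H h K κ A) {p : Fin N → ℝ} {T : ℝ}
    (hp : ∀ l, |p l| ≤ T) : |H p| ≤ K * Real.exp (κ * (N * T)) := by
  refine (hH.le_exp _).trans (mul_le_mul_of_nonneg_left (Real.exp_le_exp.2
    (mul_le_mul_of_nonneg_left ?_ hH.κ_nonneg)) hH.K_nonneg)
  calc ∑ l, |p l| ≤ ∑ _l : Fin N, T := Finset.sum_le_sum fun l _ => hp l
    _ = N * T := by simp

lemma IsTameObservable.measurable (hH : IsTameObservable H h K κ A) :
    Measurable fun η : Config d C => H fun l => η.pair (h l) :=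
  hH.cont.measurable.comp (measurable_pi_lambda _ fun l =>
    measurable_pair (hH.cont_test l) (hH.test_le l))

lemma IsTameObservable.measurable_step (hH : IsTameObservable H h K κ A) (n : ℕ) :
    Measurable fun η : Config d C => H fun l => η.pair (stepApprox n (h l)) := by
  refine hH.cont.measurable.comp (measurable_pi_lambda _ fun l => ?_)
  simp_rw [Config.pair_stepApprox]
  exact Finset.measurable_fun_sum _ fun j _ => (measurable_cellCharge n j).const_mul _

/-- The correlation inequality for discretised observables and interactions. -/
lemma IsFreeGas.lintegral_step_correlation_le (hz : 0 ≤ z) (hrC : r (Set.Icc (-C) C)ᶜ = 0)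
    (hμ₀ : IsFreeGas z r μ₀) (hv : IsAttractive v b) (hG : Continuous G)
    (hGs : HasCompactSupport G) (hG0 : ∀ x, 0 ≤ G x) (hg₁c : Continuous g₁)
    (hg₁s : HasCompactSupport g₁) (hg₂c : Continuous g₂) (hg₂s : HasCompactSupport g₂)
    (hg₁ : ∀ x, 0 ≤ g₁ x) (hg : ∀ x, g₁ x ≤ g₂ x) (hH : IsNonnegIncreasing H h K κ A) (n : ℕ) :
    (∫⁻ η, ENNReal.ofReal ((H fun l => η.pair (stepApprox n (h l))) *
        Real.exp (-stepInteraction n G v g₁ η)) ∂μ₀) *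
        ∫⁻ η, ENNReal.ofReal (Real.exp (-stepInteraction n G v g₂ η)) ∂μ₀ ≤
      (∫⁻ η, ENNReal.ofReal ((H fun l => η.pair (stepApprox n (h l))) *
        Real.exp (-stepInteraction n G v g₂ η)) ∂μ₀) *
        ∫⁻ η, ENNReal.ofReal (Real.exp (-stepInteraction n G v g₁ η)) ∂μ₀ := by
  have hX : Measurable (fun η (j : cellRange d n) => cellCharge (C := C) n j.1 η) :=
    measurable_pi_lambda _ fun j => measurable_cellCharge n j.1
  have hl : ∀ j : cellRange d n, 0 ≤ z * volume.real (cell n j.1) := fun j => by positivity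
  have := fun j : cellRange d n => isProbabilityMeasure_compoundPoisson (r := r) (hl j)
  set a : cellRange d n → Space d → ℝ := fun j x => cellAverage n j.1 fun y => G (x - y) with ha
  set Φ : (Space d → ℝ) → (cellRange d n → ℝ) → ℝ :=
    fun g ξ => ∫ x, v (∑ j, a j x * ξ j) * g x with hΦ
  set P : (cellRange d n → ℝ) → ℝ :=
    fun ξ => H fun l => ∑ j : cellRange d n, cellAverage n j.1 (h l) * ξ j with hP
  have hac : ∀ j, Continuous (a j) := fun j => continuous_cellAverage hG hGs n j.1
  have hPc : Continuous P := by
    have := hH.cont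
    fun_prop
  have hPm : Monotone P := fun ξ ζ hξ => hH.mono fun l => Finset.sum_le_sum fun j _ =>
    mul_le_mul_of_nonneg_left (hξ j) (cellAverage_nonneg (hH.test_nonneg l) n j.1)
  have key := lintegral_correlation_le (m := volume)
    (ν := fun j : cellRange d n => compoundPoisson (z * volume.real (cell n j.1)) r) hv hac
    (fun j x => cellAverage_nonneg (fun y => hG0 _) n j.1) hg₁c hg₁s hg₂c hg₂s hg₁ hg
    hPc.measurable hPm (fun ξ => hH.nonneg _) (Φ := Φ) fun g ξ => rfl
  have hm : ∀ g : Space d → ℝ, Continuous g → Measurable (Φ g) := fun g hgc =>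
    measurable_integral_linear hv.continuous hac hgc
  have hm₁ := hm g₁ hg₁c
  have hm₂ := hm g₂ hg₂c
  have hPm' := hPc.measurable
  -- The product measure is recognised as the law of the cell charges and pulled back to `μ₀`.
  rw [← hμ₀.map_cellCharge hz hrC n (cellRange d n), lintegral_map (by fun_prop) hX,
    lintegral_map (by fun_prop) hX, lintegral_map (by fun_prop) hX,
    lintegral_map (by fun_prop) hX] at key
  have e : ∀ η : Config d C, (H fun l => η.pair (stepApprox n (h l))) =
      P fun j => cellCharge n j.1 η := fun η => by
    simp only [hP]
    congr 1
    ext l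
    rw [Config.pair_stepApprox, Finset.sum_coe_sort (cellRange d n) fun j =>
      cellAverage n j (h l) * cellCharge n j η]
  simp_rw [e, stepInteraction_eq]
  exact key

/-- The correlation inequality when the kernel `G` is continuous with compact support. -/
lemma IsFreeGas.correlation_le_of_continuous (hz : 0 ≤ z) (hC : 0 ≤ C)
    (hrC : r (Set.Icc (-C) C)ᶜ = 0)
    (hμ₀ : IsFreeGas z r μ₀) (hv : IsAttractive v b) (hG : Continuous G)
    (hGs : HasCompactSupport G) (hG0 : ∀ x, 0 ≤ G x) (hg₁c : Continuous g₁)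
    (hg₁s : HasCompactSupport g₁) (hg₂c : Continuous g₂) (hg₂s : HasCompactSupport g₂)
    (hg₁ : ∀ x, 0 ≤ g₁ x) (hg : ∀ x, g₁ x ≤ g₂ x) (hH : IsNonnegIncreasing H h K κ A) :
    (∫ η, (H fun l => η.pair (h l)) * Real.exp (-interaction G v g₁ η) ∂μ₀) *
        ∫ η, Real.exp (-interaction G v g₂ η) ∂μ₀ ≤
      (∫ η, (H fun l => η.pair (h l)) * Real.exp (-interaction G v g₂ η) ∂μ₀) *
        ∫ η, Real.exp (-interaction G v g₁ η) ∂μ₀ := by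
  have hg₂ : ∀ x, 0 ≤ g₂ x := fun x => (hg₁ x).trans (hg x)
  have hi₁ : Integrable g₁ := hg₁c.integrable_of_hasCompactSupport hg₁s
  have hi₂ : Integrable g₂ := hg₂c.integrable_of_hasCompactSupport hg₂s
  obtain ⟨B, hB0, hB⟩ := exists_translate_le_weight hG hGs hg₂s
  have hB₁ : ∀ x, g₁ x ≠ 0 → ∀ y, |G (x - y)| ≤ B * weight y := fun x hx =>
    hB x fun h0 => hx (le_antisymm (h0 ▸ hg x) (hg₁ x))
  have hR : 0 ≤ weightRatio d := Real.rpow_nonneg (by positivity) _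
  have hb := hv.nonneg
  have hI : ∫ x, g₁ x ≤ ∫ x, g₂ x := integral_mono hi₁ hi₂ hg
  have hI₂ : 0 ≤ ∫ x, g₂ x := integral_nonneg hg₂
  -- The first summand bounds the exponent of the observable with its `N` pairings, the second the
  -- interaction with either cut-off; both multiply the total variation paired with `weight`,
  -- uniformly in the mesh.
  set c : ℝ := κ * (N * (|A| * weightRatio d)) + b * (B * weightRatio d) * ∫ x, g₂ x with hc
  have hκ := hH.κ_nonneg
  have hc0 : 0 ≤ c := by positivity
  obtain ⟨Z, hZi, hZ⟩ := hμ₀.exists_integrable_majorant hz hC hrC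
    (k := fun y => 2 * c * weight y) (continuous_weight.const_mul _)
    (fun y => mul_nonneg (by positivity) (weight_pos y).le) (M := 2 * c * 1)
    (fun y => mul_le_mul_of_nonneg_left (weight_le_one y) (by positivity))
    (integrable_weight.const_mul _)
  set S : Config d C → ℝ := fun η => c * ∑' y, |η.charge y| * weight y with hS
  have ht0 : ∀ η : Config d C, 0 ≤ ∑' y, |η.charge y| * weight y := fun η =>
    tsum_nonneg fun y => mul_nonneg (abs_nonneg _) (weight_pos y).le
  have hFb : ∀ n (η : Config d C), |H fun l => η.pair (stepApprox n (h l))| ≤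
      K * Real.exp (S η) := by
    intro n η
    refine (hH.abs_le (T := |A| * weightRatio d * ∑' y, |η.charge y| * weight y)
      fun l => ?_).trans ?_
    · refine η.abs_pair_le (abs_stepApprox_le (hH.cont_test l) (fun y => ?_) n)
      exact (hH.test_le l y).trans (mul_le_mul_of_nonneg_right (le_abs_self A) (weight_pos y).le)
    · refine mul_le_mul_of_nonneg_left (Real.exp_le_exp.2 ?_) hH.K_nonneg
      rw [hS, hc]
      have : 0 ≤ b * (B * weightRatio d) * (∫ x, g₂ x) * ∑' y, |η.charge y| * weight y :=
        mul_nonneg (by positivity) (ht0 η)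
      linarith
  have hUb : ∀ g : Space d → ℝ, Integrable g → (∀ x, 0 ≤ g x) →
      (∀ x, g x ≠ 0 → ∀ y, |G (x - y)| ≤ B * weight y) → ∫ x, g x ≤ ∫ x, g₂ x →
      ∀ n (η : Config d C), |stepInteraction n G v g η| ≤ S η := by
    intro g hgi hg0 hgB hgI n η
    have h1 := abs_stepInteraction_le hv hG hgi hg0 hgB n η
    have h2 := ht0 η
    refine h1.trans ((mul_le_mul_of_nonneg_left hgI (by positivity)).trans ?_)
    rw [hS, hc]
    have : 0 ≤ κ * (N * (|A| * weightRatio d)) * ∑' y, |η.charge y| * weight y := by positivity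
    linarith
  have hFm := fun n => hH.measurable_step (C := C) n
  have hSZ : ∀ᵐ η ∂μ₀, Real.exp (2 * S η) ≤ Z η := by
    filter_upwards [hZ] with η hη
    convert hη.2 using 2
    rw [hS, ← mul_assoc, ← tsum_mul_left]
    exact tsum_congr fun y => by ring
  refine correlation_le_of_tendsto (F := fun n η => H fun l => η.pair (stepApprox n (h l)))
    (V := fun n => stepInteraction n G v g₁) (W := fun n => stepInteraction n G v g₂) (S := S)
    (Z := Z) (K := K) (fun n => (hFm n).aestronglyMeasurable)
    (fun n => (measurable_stepInteraction n hG hGs hv hg₁c).aestronglyMeasurable)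
    (fun n => (measurable_stepInteraction n hG hGs hv hg₂c).aestronglyMeasurable)
    (fun n => ae_of_all _ (hFb n)) (fun n => ae_of_all _ (hUb g₁ hi₁ hg₁ hB₁ hI n))
    (fun n => ae_of_all _ (hUb g₂ hi₂ hg₂ hB le_rfl n)) hZi hSZ
    (ae_of_all _ fun η => ?_)
    (ae_of_all _ fun η => tendsto_stepInteraction hv hG hGs hg₁c hi₁ hg₁ hB₁ η)
    (ae_of_all _ fun η => tendsto_stepInteraction hv hG hGs hg₂c hi₂ hg₂ hB η) fun n => ?_
  · exact (hH.cont.tendsto _).comp (tendsto_pi_nhds.2 fun l =>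
      η.tendsto_pair_stepApprox (hH.cont_test l) (hH.test_le l))
  · have key := hμ₀.lintegral_step_correlation_le hz hrC hv hG hGs hG0 hg₁c hg₁s hg₂c hg₂s hg₁ hg
      hH n
    have hint : ∀ g : Space d → ℝ, Continuous g → Integrable g → (∀ x, 0 ≤ g x) →
        (∀ x, g x ≠ 0 → ∀ y, |G (x - y)| ≤ B * weight y) → ∫ x, g x ≤ ∫ x, g₂ x →
        Integrable (fun η : Config d C => (H fun l => η.pair (stepApprox n (h l))) *
          Real.exp (-stepInteraction n G v g η)) μ₀ ∧
        Integrable (fun η : Config d C => Real.exp (-stepInteraction n G v g η)) μ₀ := by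
      intro g hgc hgi hg0 hgB hgI
      have hm := measurable_stepInteraction (C := C) n hG hGs hv hgc
      have hb' := hUb g hgi hg0 hgB hgI n
      constructor
      · refine (hZi.const_mul K).mono' ((hFm n).mul hm.neg.exp).aestronglyMeasurable ?_
        filter_upwards [hSZ] with η hη
        rw [norm_mul, Real.norm_eq_abs, Real.norm_of_nonneg (Real.exp_nonneg _)]
        calc _ ≤ K * Real.exp (S η) * Real.exp (S η) := by
              refine mul_le_mul (hFb n η) (Real.exp_le_exp.2 ?_) (Real.exp_nonneg _)
                (mul_nonneg hH.K_nonneg (Real.exp_nonneg _))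
              linarith [(abs_le.1 (hb' η)).1]
          _ = K * Real.exp (2 * S η) := by rw [mul_assoc, ← Real.exp_add, two_mul]
          _ ≤ K * Z η := mul_le_mul_of_nonneg_left hη hH.K_nonneg
      · refine hZi.mono' hm.neg.exp.aestronglyMeasurable ?_
        filter_upwards [hSZ] with η hη
        rw [Real.norm_of_nonneg (Real.exp_nonneg _)]
        refine le_trans (Real.exp_le_exp.2 ?_) hη
        linarith [(abs_le.1 (hb' η)).1, (abs_nonneg _).trans (hb' η)]
    obtain ⟨i₁, i₂⟩ := hint g₁ hg₁c hi₁ hg₁ hB₁ hI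
    obtain ⟨i₃, i₄⟩ := hint g₂ hg₂c hi₂ hg₂ hB le_rfl
    have p : ∀ g (η : Config d C), 0 ≤ (H fun l => η.pair (stepApprox n (h l))) *
        Real.exp (-stepInteraction n G v g η) := fun g η =>
      mul_nonneg (hH.nonneg _) (Real.exp_nonneg _)
    have q : ∀ g (η : Config d C), 0 ≤ Real.exp (-stepInteraction n G v g η) := fun g η =>
      Real.exp_nonneg _
    rw [← ofReal_integral_eq_lintegral_ofReal i₁ (ae_of_all _ (p g₁)),
      ← ofReal_integral_eq_lintegral_ofReal i₂ (ae_of_all _ (q g₁)),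
      ← ofReal_integral_eq_lintegral_ofReal i₃ (ae_of_all _ (p g₂)),
      ← ofReal_integral_eq_lintegral_ofReal i₄ (ae_of_all _ (q g₂)),
      ← ENNReal.ofReal_mul (integral_nonneg (p g₁)),
      ← ENNReal.ofReal_mul (integral_nonneg (p g₂))] at key
    exact (ENNReal.ofReal_le_ofReal_iff
      (mul_nonneg (integral_nonneg (p g₂)) (integral_nonneg (q g₁)))).1 key

end Correlation

end WeakAttraction

end

/-! ### Smeared kernels. -/

noncomputable section

namespace WeakAttraction

open scoped Topology ENNReal

variable {d : ℕ} {C : ℝ}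

/-- The smeared kernel `y ↦ ∫ |E (x - y)| g x dx`. -/
def smear (E g : Space d → ℝ) (y : Space d) : ℝ := ∫ x, |E (x - y)| * g x

section Smear

variable {E E₁ E₂ g : Space d → ℝ} {M : ℝ}

/-- This moves `y` from the merely integrable `E` into the continuous `g`, so that continuity in `y`
follows by domination. -/
lemma smear_eq (E g : Space d → ℝ) (y : Space d) : smear E g y = ∫ u, |E u| * g (u + y) := by
  rw [smear, ← integral_add_right_eq_self _ y]
  simp

lemma smear_nonneg (hg0 : ∀ x, 0 ≤ g x) (y : Space d) : 0 ≤ smear E g y :=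
  integral_nonneg fun x => mul_nonneg (abs_nonneg _) (hg0 x)

lemma integrable_smear_integrand (hE : Integrable E) (hg : Continuous g) (hM : ∀ x, ‖g x‖ ≤ M)
    (y : Space d) : Integrable fun x => |E (x - y)| * g x := by
  have h1 : Integrable fun x => |E (x - y)| := (hE.comp_sub_right y).abs
  refine (h1.mul_const M).mono' (h1.aestronglyMeasurable.mul hg.aestronglyMeasurable)
    (ae_of_all _ fun x => ?_)
  rw [norm_mul, Real.norm_eq_abs, abs_abs]
  exact mul_le_mul_of_nonneg_left (hM x) (abs_nonneg _)

lemma continuous_smear (hE : Integrable E) (hg : Continuous g) (hM : ∀ x, ‖g x‖ ≤ M) :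
    Continuous (smear E g) := by
  rw [funext (smear_eq E g)]
  refine continuous_of_dominated (F := fun y u => |E u| * g (u + y)) (bound := fun u => |E u| * M)
    (fun y => ?_) (fun y => ae_of_all _ fun u => ?_) (hE.abs.mul_const M)
    (ae_of_all _ fun u => by fun_prop)
  · exact hE.abs.aestronglyMeasurable.mul (Continuous.aestronglyMeasurable (by fun_prop))
  · rw [norm_mul, Real.norm_eq_abs, abs_abs]
    exact mul_le_mul_of_nonneg_left (hM _) (abs_nonneg _)

lemma smear_le (hE : Integrable E) (hg : Continuous g) (hM : ∀ x, ‖g x‖ ≤ M) (y : Space d) :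
    smear E g y ≤ M * ∫ u, |E u| := by
  rw [smear_eq, mul_comm, ← integral_mul_const]
  have h1 : Integrable fun u => |E u| * g (u + y) := by
    have := (integrable_smear_integrand hE hg hM y).comp_add_right y
    simpa using this
  refine integral_mono h1 (hE.abs.mul_const M) fun u => ?_
  exact mul_le_mul_of_nonneg_left ((le_abs_self _).trans (hM _)) (abs_nonneg _)

lemma integrable_smear_prod (hE : Integrable E) (hg : Integrable g) :
    Integrable (fun p : Space d × Space d => |E p.1| * g (p.1 + p.2)) (volume.prod volume) :=
  (measurePreserving_prod_add (volume : Measure (Space d)) volume).integrable_comp_of_integrable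
    (hE.abs.mul_prod hg)

lemma integrable_smear (hE : Integrable E) (hg : Integrable g) : Integrable (smear E g) := by
  rw [funext (smear_eq E g)]
  exact (integrable_smear_prod hE hg).integral_prod_right

lemma integral_smear (hE : Integrable E) (hg : Integrable g) :
    ∫ y, smear E g y = (∫ u, |E u|) * ∫ x, g x := by
  rw [funext (smear_eq E g), ← integral_integral_swap (integrable_smear_prod hE hg),
    ← integral_mul_const]
  refine integral_congr_ae (ae_of_all _ fun u => ?_)
  simp only
  rw [integral_const_mul]
  congr 1
  exact integral_add_left_eq_self _ u

lemma smear_le_add (hE₁ : Integrable E₁) (hE₂ : Integrable E₂) (hg : Continuous g)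
    (hM : ∀ x, ‖g x‖ ≤ M) (hg0 : ∀ x, 0 ≤ g x) (y : Space d) :
    smear E₁ g y ≤ smear E₂ g y + smear (E₁ - E₂) g y := by
  rw [smear, smear, smear, ← integral_add (integrable_smear_integrand hE₂ hg hM y)
    (integrable_smear_integrand (hE₁.sub hE₂) hg hM y)]
  refine integral_mono (integrable_smear_integrand hE₁ hg hM y)
    ((integrable_smear_integrand hE₂ hg hM y).add
    (integrable_smear_integrand (hE₁.sub hE₂) hg hM y)) fun x => ?_
  change _ ≤ |E₂ (x - y)| * g x + |(E₁ - E₂) (x - y)| * g x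
  rw [← add_mul]
  refine mul_le_mul_of_nonneg_right ?_ (hg0 x)
  have := abs_add_le (E₂ (x - y)) (E₁ (x - y) - E₂ (x - y))
  rwa [add_sub_cancel] at this

lemma smear_mono {g₁ g₂ : Space d → ℝ} (hE : Integrable E) (hg₁ : Continuous g₁)
    (hg₂ : Continuous g₂) {M₁ M₂ : ℝ} (hM₁ : ∀ x, ‖g₁ x‖ ≤ M₁) (hM₂ : ∀ x, ‖g₂ x‖ ≤ M₂)
    (hg : ∀ x, g₁ x ≤ g₂ x) (y : Space d) : smear E g₁ y ≤ smear E g₂ y :=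
  integral_mono (integrable_smear_integrand hE hg₁ hM₁ y)
    (integrable_smear_integrand hE hg₂ hM₂ y)
    fun x => mul_le_mul_of_nonneg_left (hg x) (abs_nonneg _)

end Smear

/-! ### The field of an integrable kernel. -/

section Field

variable {E E₁ E₂ g k : Space d → ℝ} {M : ℝ}

/-- A summable family has countable support, and the weight never vanishes. Countability is what
permits exchanging sums over atoms with integrals over `x`. -/
lemma Config.countable_support (η : Config d C) : (Function.support η.charge).Countable := by
  refine η.summable_abs_mul_weight.countable_support.mono fun y hy => ?_
  exact mul_ne_zero (abs_ne_zero.2 hy) (weight_pos y).ne'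

lemma Config.tsum_enorm_eq (η : Config d C) (E : Space d → ℝ) (x : Space d) :
    ∑' y, ‖η.charge y * E (x - y)‖ₑ =
      ∑' y : Function.support η.charge, ‖η.charge y * E (x - y)‖ₑ := by
  refine (tsum_subtype_eq_of_support_subset fun y hy => ?_).symm
  contrapose! hy
  rw [Function.notMem_support] at hy
  simp [hy]

lemma Config.aemeasurable_tsum_enorm (η : Config d C) (hE : Integrable E) :
    AEMeasurable (fun x => ∑' y, ‖η.charge y * E (x - y)‖ₑ) := by
  have := η.countable_support.to_subtype
  simp_rw [η.tsum_enorm_eq]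
  refine AEMeasurable.tsum fun y => ?_
  exact ((hE.comp_sub_right y.1).aestronglyMeasurable.const_mul _).enorm

/-- Tonelli over the countable support. It trades the field, integrated against `g`, for a pairing
of `|η|` with `smear E g`, to which the exponential moment bound applies. -/
lemma Config.lintegral_tsum_enorm (η : Config d C) (hE : Integrable E) (hg : Continuous g)
    (hM : ∀ x, ‖g x‖ ≤ M) (hg0 : ∀ x, 0 ≤ g x) :
    ∫⁻ x, (∑' y, ‖η.charge y * E (x - y)‖ₑ) * ‖g x‖ₑ =
      ∑' y, ENNReal.ofReal (|η.charge y| * smear E g y) := by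
  have := η.countable_support.to_subtype
  have e : ∀ y, ∫⁻ x, ‖η.charge y * E (x - y)‖ₑ * ‖g x‖ₑ =
      ENNReal.ofReal (|η.charge y| * smear E g y) := by
    intro y
    have h1 := (integrable_smear_integrand hE hg hM y).const_mul |η.charge y|
    rw [smear, ← integral_const_mul, ofReal_integral_eq_lintegral_ofReal h1
      (ae_of_all _ fun x => mul_nonneg (abs_nonneg _) (mul_nonneg (abs_nonneg _) (hg0 x)))]
    refine lintegral_congr fun x => ?_
    rw [← enorm_mul, ← ofReal_norm, norm_mul, norm_mul, Real.norm_eq_abs,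
      Real.norm_eq_abs, Real.norm_of_nonneg (hg0 x), mul_assoc]
  calc ∫⁻ x, (∑' y, ‖η.charge y * E (x - y)‖ₑ) * ‖g x‖ₑ
      = ∫⁻ x, ∑' y : Function.support η.charge, ‖η.charge y * E (x - y)‖ₑ * ‖g x‖ₑ :=
        lintegral_congr fun x => by rw [η.tsum_enorm_eq, ENNReal.tsum_mul_right]
    _ = ∑' y : Function.support η.charge, ∫⁻ x, ‖η.charge y * E (x - y)‖ₑ * ‖g x‖ₑ :=
        lintegral_tsum fun y =>
          (((hE.comp_sub_right y.1).aestronglyMeasurable.const_mul _).enorm).mul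
            hg.aestronglyMeasurable.enorm
    _ = ∑' y : Function.support η.charge, ENNReal.ofReal (|η.charge y| * smear E g y) :=
        tsum_congr fun y => e y
    _ = ∑' y, ENNReal.ofReal (|η.charge y| * smear E g y) := by
        refine tsum_subtype_eq_of_support_subset (f := fun y =>
          ENNReal.ofReal (|η.charge y| * smear E g y)) fun y hy => ?_
        contrapose! hy
        rw [Function.notMem_support] at hy
        simp [hy]

lemma Config.lintegral_tsum_enorm_le (η : Config d C) (hE : Integrable E) (hg : Continuous g)
    (hM : ∀ x, ‖g x‖ ≤ M) (hg0 : ∀ x, 0 ≤ g x) (hk : ∀ y, smear E g y ≤ k y)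
    (hs : Summable fun y => |η.charge y| * k y) :
    ∫⁻ x, (∑' y, ‖η.charge y * E (x - y)‖ₑ) * ‖g x‖ₑ ≤
      ENNReal.ofReal (∑' y, |η.charge y| * k y) := by
  have h0 : ∀ y, 0 ≤ |η.charge y| * k y := fun y =>
    mul_nonneg (abs_nonneg _) ((smear_nonneg hg0 y).trans (hk y))
  rw [η.lintegral_tsum_enorm hE hg hM hg0, ENNReal.ofReal_tsum_of_nonneg h0 hs]
  exact ENNReal.tsum_le_tsum fun y =>
    ENNReal.ofReal_le_ofReal (mul_le_mul_of_nonneg_left (hk y) (abs_nonneg _))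

/-- For an integrable kernel the series may diverge at some `x`; finiteness of the integrated series
excludes this almost everywhere on `g ≠ 0`. -/
lemma Config.ae_summable_field (η : Config d C) (hE : Integrable E) (hg : Continuous g)
    (hM : ∀ x, ‖g x‖ ≤ M) (hg0 : ∀ x, 0 ≤ g x) (hk : ∀ y, smear E g y ≤ k y)
    (hs : Summable fun y => |η.charge y| * k y) :
    ∀ᵐ x, g x ≠ 0 → Summable fun y => η.charge y * E (x - y) := by
  have h1 := ae_lt_top' ((η.aemeasurable_tsum_enorm hE).mul hg.aestronglyMeasurable.enorm)
    (ne_top_of_le_ne_top ENNReal.ofReal_ne_top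
      (η.lintegral_tsum_enorm_le hE hg hM hg0 hk hs))
  filter_upwards [h1] with x hx hgx
  refine Summable.of_enorm fun htop => ?_
  rw [Pi.mul_apply, htop, ENNReal.top_mul (by simpa using hgx)] at hx
  exact lt_irrefl _ hx

lemma Config.aestronglyMeasurable_comp_field (η : Config d C) (hE : Integrable E)
    (hg : Continuous g) (hM : ∀ x, ‖g x‖ ≤ M) (hg0 : ∀ x, 0 ≤ g x)
    (hk : ∀ y, smear E g y ≤ k y) (hs : Summable fun y => |η.charge y| * k y) {v : ℝ → ℝ}
    (hv : Continuous v) : AEStronglyMeasurable (fun x => v (field E η x) * g x) := by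
  have := η.countable_support.to_subtype
  -- Because the support is countable, `atTop` on its finite subsets is countably generated, as
  -- limits of measurable functions require.
  refine aestronglyMeasurable_of_tendsto_ae (u := (atTop : Filter (Finset
    (Function.support η.charge)))) (f := fun S x =>
      v (∑ y ∈ S, η.charge y.1 * E (x - y.1)) * g x) (fun S => ?_) ?_
  · refine (hv.comp_aestronglyMeasurable ?_).mul hg.aestronglyMeasurable
    exact Finset.aestronglyMeasurable_fun_sum _ fun y _ =>
      (hE.comp_sub_right y.1).aestronglyMeasurable.const_mul _
  · filter_upwards [η.ae_summable_field hE hg hM hg0 hk hs] with x hx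
    by_cases hgx : g x = 0
    · simp [hgx]
    · refine ((hv.tendsto _).comp ?_).mul_const _
      have h1 : Function.support (fun y => η.charge y * E (x - y)) ⊆ Function.support η.charge :=
        Function.support_mul_subset_left _ _
      exact (hasSum_subtype_iff_of_support_subset h1).2 (hx hgx).hasSum

/-- The function `p` is left free for two uses: `v` of the field bounds an interaction, and a
difference of two such functions, with `E` the difference of the kernels, gives Lipschitz dependence
on the kernel. -/
lemma Config.lintegral_enorm_comp_field_le (η : Config d C) {v : ℝ → ℝ} {b : ℝ}
    (hv : IsAttractive v b) (hE : Integrable E)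
    (hg : Continuous g) (hM : ∀ x, ‖g x‖ ≤ M) (hg0 : ∀ x, 0 ≤ g x)
    (hk : ∀ y, smear E g y ≤ k y) (hs : Summable fun y => |η.charge y| * k y) {p : Space d → ℝ}
    (hp : ∀ᵐ x, g x ≠ 0 → |p x| ≤ b * |field E η x|) :
    ∫⁻ x, ‖p x * g x‖ₑ ≤ ENNReal.ofReal (b * ∑' y, |η.charge y| * k y) := by
  calc ∫⁻ x, ‖p x * g x‖ₑ
      ≤ ∫⁻ x, ENNReal.ofReal b * ((∑' y, ‖η.charge y * E (x - y)‖ₑ) * ‖g x‖ₑ) := by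
        refine lintegral_mono_ae ?_
        filter_upwards [hp] with x hx
        by_cases hgx : g x = 0
        · simp [hgx]
        · rw [enorm_mul, ← mul_assoc]
          refine mul_le_mul_left ?_ _
          calc ‖p x‖ₑ ≤ ENNReal.ofReal (b * |field E η x|) := by
                rw [← ofReal_norm]
                exact ENNReal.ofReal_le_ofReal (hx hgx)
            _ = ENNReal.ofReal b * ‖field E η x‖ₑ := by
                rw [ENNReal.ofReal_mul hv.nonneg, ← Real.norm_eq_abs, ofReal_norm]
            _ ≤ _ := mul_le_mul_right enorm_tsum_le_tsum_enorm _
    _ = ENNReal.ofReal b * ∫⁻ x, (∑' y, ‖η.charge y * E (x - y)‖ₑ) * ‖g x‖ₑ :=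
        lintegral_const_mul' _ _ ENNReal.ofReal_ne_top
    _ ≤ _ := by
        rw [ENNReal.ofReal_mul hv.nonneg]
        exact mul_le_mul_right (η.lintegral_tsum_enorm_le hE hg hM hg0 hk hs) _

lemma abs_integral_le_of_lintegral_enorm_le {f : Space d → ℝ} {T : ℝ} (hT : 0 ≤ T)
    (h : ∫⁻ x, ‖f x‖ₑ ≤ ENNReal.ofReal T) : |∫ x, f x| ≤ T := by
  have := (enorm_integral_le_lintegral_enorm f).trans h
  rwa [← ofReal_norm, ENNReal.ofReal_le_ofReal_iff hT, Real.norm_eq_abs] at this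

lemma Config.tsum_abs_mul_nonneg (η : Config d C) (hk : ∀ y, 0 ≤ k y) :
    0 ≤ ∑' y, |η.charge y| * k y :=
  tsum_nonneg fun y => mul_nonneg (abs_nonneg _) (hk y)

lemma Config.abs_interaction_le (η : Config d C) {v : ℝ → ℝ} {b : ℝ}
    (hv : IsAttractive v b) (hE : Integrable E)
    (hg : Continuous g) (hM : ∀ x, ‖g x‖ ≤ M) (hg0 : ∀ x, 0 ≤ g x)
    (hk : ∀ y, smear E g y ≤ k y) (hs : Summable fun y => |η.charge y| * k y) :
    |interaction E v g η| ≤ b * ∑' y, |η.charge y| * k y :=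
  abs_integral_le_of_lintegral_enorm_le
    (mul_nonneg hv.nonneg (η.tsum_abs_mul_nonneg fun y => (smear_nonneg hg0 y).trans (hk y)))
    (η.lintegral_enorm_comp_field_le hv hE hg hM hg0 hk hs
      (ae_of_all _ fun _ _ => hv.abs_le _))

lemma Config.integrable_comp_field (η : Config d C) {v : ℝ → ℝ} {b : ℝ}
    (hv : IsAttractive v b) (hE : Integrable E)
    (hg : Continuous g) (hM : ∀ x, ‖g x‖ ≤ M) (hg0 : ∀ x, 0 ≤ g x)
    (hk : ∀ y, smear E g y ≤ k y) (hs : Summable fun y => |η.charge y| * k y) :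
    Integrable fun x => v (field E η x) * g x :=
  ⟨η.aestronglyMeasurable_comp_field hE hg hM hg0 hk hs hv.continuous,
    (η.lintegral_enorm_comp_field_le hv hE hg hM hg0 hk hs
      (ae_of_all _ fun _ _ => hv.abs_le _)).trans_lt ENNReal.ofReal_lt_top⟩

lemma Config.abs_interaction_sub_le (η : Config d C) {v : ℝ → ℝ} {b : ℝ}
    (hv : IsAttractive v b) (hE₁ : Integrable E₁) (hE₂ : Integrable E₂)
    (hg : Continuous g) (hM : ∀ x, ‖g x‖ ≤ M) (hg0 : ∀ x, 0 ≤ g x) {k₁ k₂ : Space d → ℝ}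
    (hk₁ : ∀ y, smear E₁ g y ≤ k₁ y) (hs₁ : Summable fun y => |η.charge y| * k₁ y)
    (hk₂ : ∀ y, smear E₂ g y ≤ k₂ y) (hs₂ : Summable fun y => |η.charge y| * k₂ y)
    (hk : ∀ y, smear (E₁ - E₂) g y ≤ k y) (hs : Summable fun y => |η.charge y| * k y) :
    |interaction E₁ v g η - interaction E₂ v g η| ≤ b * ∑' y, |η.charge y| * k y := by
  rw [interaction, interaction, ← integral_sub
    (η.integrable_comp_field hv hE₁ hg hM hg0 hk₁ hs₁)
    (η.integrable_comp_field hv hE₂ hg hM hg0 hk₂ hs₂)]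
  simp_rw [← sub_mul]
  refine abs_integral_le_of_lintegral_enorm_le
    (mul_nonneg hv.nonneg (η.tsum_abs_mul_nonneg fun y => (smear_nonneg hg0 y).trans (hk y)))
    (η.lintegral_enorm_comp_field_le hv (hE₁.sub hE₂) hg hM hg0 hk hs ?_)
  -- The field is additive in the kernel where both series converge, hence at almost every relevant
  -- `x`.
  filter_upwards [η.ae_summable_field hE₁ hg hM hg0 hk₁ hs₁,
    η.ae_summable_field hE₂ hg hM hg0 hk₂ hs₂] with x h1 h2 hgx
  have : field (E₁ - E₂) η x = field E₁ η x - field E₂ η x := by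
    rw [field, field, field, pair, pair, pair, ← (h1 hgx).tsum_sub (h2 hgx)]
    exact tsum_congr fun y => by rw [Pi.sub_apply, mul_sub]
  rw [this]
  exact hv.lipschitz _ _

end Field

/-! ### Approximation of an integrable kernel. -/

section Approximation

/-- Approximation of an integrable kernel by continuous kernels, with a common bound of the
smeared differences. -/
lemma exists_kernel_approx {G g : Space d → ℝ} (hG : Integrable G) (hG0 : ∀ x, 0 ≤ G x)
    (hg : Continuous g) (hgs : HasCompactSupport g) (hg0 : ∀ x, 0 ≤ g x) :
    ∃ (Gs : ℕ → Space d → ℝ) (k : Space d → ℝ) (M : ℝ), (∀ m, Continuous (Gs m)) ∧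
      (∀ m, HasCompactSupport (Gs m)) ∧ (∀ m x, 0 ≤ Gs m x) ∧ Continuous k ∧ Integrable k ∧
      (∀ y, k y ≤ M) ∧ (∀ m y, smear (Gs m - G) g y ≤ k y) ∧
      ∀ y, Tendsto (fun m => smear (Gs m - G) g y) atTop (𝓝 0) := by
  obtain ⟨M, hM⟩ := hgs.exists_bound_of_continuous hg
  have hgi : Integrable g := hg.integrable_of_hasCompactSupport hgs
  have hM0 : 0 ≤ M := (norm_nonneg _).trans (hM 0)
  -- Geometric errors make the smeared differences summable in `m`; their sum is a single
  -- continuous, bounded, integrable majorant, and summability forces the terms to 0.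
  choose Gs' hs' hle' hc' hi' using fun m : ℕ =>
    hG.exists_hasCompactSupport_integral_sub_le (ε := (1 / 2 : ℝ) ^ m) (by positivity)
  -- The positive part is 1-Lipschitz and fixes `G ≥ 0`, so it does not enlarge the `L¹` error.
  set Gs : ℕ → Space d → ℝ := fun m x => max (Gs' m x) 0 with hGs
  have hc : ∀ m, Continuous (Gs m) := fun m => (hc' m).max continuous_const
  have hs : ∀ m, HasCompactSupport (Gs m) := fun m =>
    (hs' m).comp_left (g := fun t => max t 0) (max_self 0)
  have hi : ∀ m, Integrable (Gs m) := fun m => (hc m).integrable_of_hasCompactSupport (hs m)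
  have hd : ∀ m, Integrable (Gs m - G) := fun m => (hi m).sub hG
  have hle : ∀ m, ∫ x, |(Gs m - G) x| ≤ (1 / 2 : ℝ) ^ m := by
    intro m
    refine le_trans (integral_mono (hd m).abs (hG.sub (hi' m)).norm fun x => ?_) (hle' m)
    have h1 := abs_max_sub_max_le_abs (Gs' m x) (G x) 0
    rw [max_eq_left (hG0 x)] at h1
    rw [Pi.sub_apply, Pi.sub_apply, Real.norm_eq_abs, abs_sub_comm (G x)]
    exact h1
  have hgeo : Summable fun m : ℕ => M * (1 / 2 : ℝ) ^ m := summable_geometric_two.mul_left M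
  have hkm0 : ∀ m y, 0 ≤ smear (Gs m - G) g y := fun m y => smear_nonneg hg0 y
  have hkm : ∀ m y, smear (Gs m - G) g y ≤ M * (1 / 2 : ℝ) ^ m := fun m y =>
    (smear_le (hd m) hg hM y).trans (mul_le_mul_of_nonneg_left (hle m) hM0)
  have hkn : ∀ m y, ‖smear (Gs m - G) g y‖ ≤ M * (1 / 2 : ℝ) ^ m := fun m y => by
    rw [Real.norm_of_nonneg (hkm0 m y)]; exact hkm m y
  have hsum : ∀ y, Summable fun m => smear (Gs m - G) g y := fun y =>
    Summable.of_norm_bounded hgeo fun m => hkn m y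
  have hcont : Continuous fun y => ∑' m, smear (Gs m - G) g y :=
    continuous_tsum (fun m => continuous_smear (hd m) hg hM) hgeo hkn
  refine ⟨Gs, fun y => ∑' m, smear (Gs m - G) g y, ∑' m, M * (1 / 2 : ℝ) ^ m, hc, hs,
    fun m x => le_max_right _ _, hcont, ⟨hcont.aestronglyMeasurable, ?_⟩,
    fun y => (hsum y).tsum_le_tsum (fun m => hkm m y) hgeo,
    fun m y => (hsum y).le_tsum m fun j _ => hkm0 j y,
    fun y => (hsum y).tendsto_atTop_zero⟩
  have hgI : 0 ≤ ∫ x, g x := integral_nonneg hg0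
  have hgeo' : Summable fun m : ℕ => (1 / 2 : ℝ) ^ m * ∫ x, g x :=
    summable_geometric_two.mul_right _
  calc ∫⁻ y, ‖∑' m, smear (Gs m - G) g y‖ₑ
      ≤ ∫⁻ y, ∑' m, ‖smear (Gs m - G) g y‖ₑ := lintegral_mono fun y => enorm_tsum_le_tsum_enorm
    _ = ∑' m, ∫⁻ y, ‖smear (Gs m - G) g y‖ₑ := lintegral_tsum fun m =>
        (continuous_smear (hd m) hg hM).aestronglyMeasurable.enorm
    _ ≤ ∑' m, ENNReal.ofReal ((1 / 2 : ℝ) ^ m * ∫ x, g x) := by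
        refine ENNReal.tsum_le_tsum fun m => ?_
        have h1 : ∀ y, ‖smear (Gs m - G) g y‖ₑ = ENNReal.ofReal (smear (Gs m - G) g y) := fun y => by
          rw [← ofReal_norm, Real.norm_of_nonneg (hkm0 m y)]
        simp_rw [h1]
        rw [← ofReal_integral_eq_lintegral_ofReal (integrable_smear (hd m) hgi)
          (ae_of_all _ (hkm0 m)), integral_smear (hd m) hgi]
        exact ENNReal.ofReal_le_ofReal (mul_le_mul_of_nonneg_right (hle m) hgI)
    _ = ENNReal.ofReal (∑' m : ℕ, (1 / 2 : ℝ) ^ m * ∫ x, g x) :=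
        (ENNReal.ofReal_tsum_of_nonneg (fun m => by positivity) hgeo').symm
    _ < ∞ := ENNReal.ofReal_lt_top

variable {z : ℝ} {r : Measure ℝ} [IsProbabilityMeasure r] {μ₀ : Measure (Config d C)}
  {v : ℝ → ℝ} {b : ℝ} {G g₁ g₂ : Space d → ℝ}

/-- Approximation of the interactions with exponentially integrable majorant. -/
lemma IsFreeGas.exists_interaction_approx (hz : 0 ≤ z) (hC : 0 ≤ C)
    (hrC : r (Set.Icc (-C) C)ᶜ = 0) (hμ₀ : IsFreeGas z r μ₀) (hv : IsAttractive v b) (hb : 0 < b)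
    (hG : Integrable G) (hG0 : ∀ x, 0 ≤ G x) (hg₁c : Continuous g₁)
    (hg₁s : HasCompactSupport g₁) (hg₂c : Continuous g₂) (hg₂s : HasCompactSupport g₂)
    (hg₁ : ∀ x, 0 ≤ g₁ x) (hg : ∀ x, g₁ x ≤ g₂ x) {c : ℝ} (hc : 0 ≤ c) :
    ∃ (Gs : ℕ → Space d → ℝ) (S Z : Config d C → ℝ), (∀ m, Continuous (Gs m)) ∧
      (∀ m, HasCompactSupport (Gs m)) ∧ (∀ m x, 0 ≤ Gs m x) ∧ Integrable Z μ₀ ∧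
      ∀ᵐ η ∂μ₀, Real.exp (2 * S η) ≤ Z η ∧ c * ∑' y, |η.charge y| * weight y ≤ S η ∧
        ∀ g ∈ ({g₁, g₂} : Set (Space d → ℝ)), |interaction G v g η| ≤ S η ∧
          (∀ m, |interaction (Gs m) v g η| ≤ S η) ∧
          Tendsto (fun m => interaction (Gs m) v g η) atTop (𝓝 (interaction G v g η)) := by
  have hg₂ : ∀ x, 0 ≤ g₂ x := fun x => (hg₁ x).trans (hg x)
  obtain ⟨M₂, hM₂⟩ := hg₂s.exists_bound_of_continuous hg₂c
  have hM0 : 0 ≤ M₂ := (norm_nonneg _).trans (hM₂ 0)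
  obtain ⟨Gs, kD, MD, hGc, hGs, hGs0, hkc, hki, hkM, hkle, hkt⟩ :=
    exists_kernel_approx hG hG0 hg₂c hg₂s hg₂
  have hGi : ∀ m, Integrable (Gs m) := fun m => (hGc m).integrable_of_hasCompactSupport (hGs m)
  set kG := smear G g₂ with hkG
  have hkG0 : ∀ y, 0 ≤ kG y := smear_nonneg hg₂
  have hkD0 : ∀ y, 0 ≤ kD y := fun y => (smear_nonneg hg₂ y).trans (hkle 0 y)
  -- The weight term is for the observable, `kG` for the limit kernel, and `kG + kD` for every
  -- approximating kernel by the triangle inequality. Built with `g₂`, the smeared bounds also cover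
  -- the smaller `g₁`.
  set k : Space d → ℝ := fun y => c * weight y + b * (kG y + kD y) with hk
  have hcw : ∀ y : Space d, 0 ≤ c * weight y := fun y => mul_nonneg hc (weight_pos y).le
  have hbk : ∀ y, 0 ≤ b * (kG y + kD y) := fun y =>
    mul_nonneg hb.le (add_nonneg (hkG0 y) (hkD0 y))
  have hkGc : Continuous kG := continuous_smear hG hg₂c hM₂
  have hkGi : Integrable kG := integrable_smear hG (hg₂c.integrable_of_hasCompactSupport hg₂s)
  obtain ⟨Z, hZi, hZ⟩ := hμ₀.exists_integrable_majorant hz hC hrC (k := fun y => 2 * k y)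
    (by have := continuous_weight (d := d); fun_prop)
    (fun y => mul_nonneg zero_le_two (add_nonneg (hcw y) (hbk y)))
    (M := 2 * (c * 1 + b * (M₂ * (∫ u, |G u|) + MD)))
    (fun y => by
      have h1 := weight_le_one y
      have h2 : kG y ≤ M₂ * ∫ u, |G u| := smear_le hG hg₂c hM₂ y
      have h3 := hkM y
      simp only [hk]
      gcongr)
    (((integrable_weight.const_mul c).add ((hkGi.add hki).const_mul b)).const_mul 2)
  refine ⟨Gs, fun η => ∑' y, |η.charge y| * k y, Z, hGc, hGs, hGs0, hZi, ?_⟩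
  filter_upwards [hZ] with η ⟨hs2, hη⟩
  have hs : Summable fun y => |η.charge y| * k y := by
    refine (hs2.mul_left (1 / 2)).congr fun y => by ring
  have hsub : ∀ (k' : Space d → ℝ), (∀ y, 0 ≤ k' y) → (∀ y, b * k' y ≤ k y) →
      (Summable fun y => |η.charge y| * k' y) ∧
      b * ∑' y, |η.charge y| * k' y ≤ ∑' y, |η.charge y| * k y := by
    intro k' h0 h1
    have hle : ∀ y, b * (|η.charge y| * k' y) ≤ |η.charge y| * k y := fun y => by
      rw [mul_left_comm]; exact mul_le_mul_of_nonneg_left (h1 y) (abs_nonneg _)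
    have h2 : Summable fun y => b * (|η.charge y| * k' y) :=
      Summable.of_nonneg_of_le (fun y => mul_nonneg hb.le (mul_nonneg (abs_nonneg _) (h0 y))) hle hs
    refine ⟨(summable_mul_left_iff hb.ne').1 h2, ?_⟩
    rw [← tsum_mul_left]
    exact h2.tsum_le_tsum hle hs
  obtain ⟨sG, bG⟩ := hsub kG hkG0 fun y => by
    simp only [hk]; nlinarith [hcw y, mul_nonneg hb.le (hkD0 y)]
  obtain ⟨sD, -⟩ := hsub kD hkD0 fun y => by
    simp only [hk]; nlinarith [hcw y, mul_nonneg hb.le (hkG0 y)]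
  obtain ⟨sS, bS⟩ := hsub (fun y => kG y + kD y) (fun y => add_nonneg (hkG0 y) (hkD0 y))
    fun y => by simp only [hk]; linarith [hcw y]
  refine ⟨?_, ?_, ?_⟩
  · convert hη using 2
    rw [← tsum_mul_left]
    exact tsum_congr fun y => by ring
  · rw [← tsum_mul_left]
    refine (η.summable_abs_mul_weight.mul_left c).tsum_le_tsum (fun y => ?_) hs
    rw [mul_left_comm]
    refine mul_le_mul_of_nonneg_left ?_ (abs_nonneg _)
    simp only [hk]
    linarith [hbk y]
  · intro g hgm
    have hgc : Continuous g := by rcases hgm with rfl | rfl <;> assumption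
    have hg0 : ∀ x, 0 ≤ g x := by rcases hgm with rfl | rfl <;> assumption
    have hgs : HasCompactSupport g := by rcases hgm with rfl | rfl <;> assumption
    have hgle : ∀ x, g x ≤ g₂ x := by
      rcases hgm with rfl | rfl
      · exact hg
      · exact fun x => le_rfl
    obtain ⟨M, hM⟩ := hgs.exists_bound_of_continuous hgc
    have hle : ∀ E : Space d → ℝ, Integrable E → ∀ y, smear E g y ≤ smear E g₂ y := fun E hE =>
      smear_mono hE hgc hg₂c hM hM₂ hgle
    have hGsk : ∀ m y, smear (Gs m) g y ≤ kG y + kD y := fun m y =>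
      (hle _ (hGi m) y).trans ((smear_le_add (hGi m) hG hg₂c hM₂ hg₂ y).trans
        (add_le_add le_rfl (hkle m y)))
    refine ⟨(η.abs_interaction_le hv hG hgc hM hg0 (hle G hG) sG).trans bG,
      fun m => (η.abs_interaction_le hv (hGi m) hgc hM hg0 (hGsk m) sS).trans bS, ?_⟩
    have hsm : ∀ m, Summable fun y => |η.charge y| * smear (Gs m - G) g₂ y := fun m =>
      Summable.of_nonneg_of_le (fun y => mul_nonneg (abs_nonneg _) (smear_nonneg hg₂ y))
        (fun y => mul_le_mul_of_nonneg_left (hkle m y) (abs_nonneg _)) sD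
    have h1 : Tendsto (fun m => b * ∑' y, |η.charge y| * smear (Gs m - G) g₂ y) atTop (𝓝 0) := by
      have := tendsto_tsum_of_dominated_convergence sD
        (f := fun m y => |η.charge y| * smear (Gs m - G) g₂ y) (g := fun _ => 0) (𝓕 := atTop)
        (fun y => by simpa using (hkt y).const_mul |η.charge y|)
        (Eventually.of_forall fun m y => by
          rw [Real.norm_of_nonneg (mul_nonneg (abs_nonneg _) (smear_nonneg hg₂ y))]
          exact mul_le_mul_of_nonneg_left (hkle m y) (abs_nonneg _))
      simpa using this.const_mul b
    refine tendsto_iff_norm_sub_tendsto_zero.2 (squeeze_zero (fun m => norm_nonneg _)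
      (fun m => ?_) h1)
    exact η.abs_interaction_sub_le hv (hGi m) hG hgc hM hg0 (hGsk m) sS (hle G hG) sG
      (hle _ ((hGi m).sub hG)) (hsm m)

end Approximation

/-! ### Integrability, the correlation inequality for integrable kernels, and reductions. -/

section Main

variable {z : ℝ} {r : Measure ℝ} [IsProbabilityMeasure r] {μ₀ : Measure (Config d C)}
  {v : ℝ → ℝ} {b : ℝ} {g₁ g₂ : Space d → ℝ} {N : ℕ} {H : (Fin N → ℝ) → ℝ}
  {h : Fin N → Space d → ℝ} {K κ A : ℝ} {G : Space d → ℝ}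

lemma IsFreeGas.ae_abs_observable_le (hH : IsTameObservable H h K κ A) {S : Config d C → ℝ}
    (hS : ∀ᵐ η ∂μ₀, κ * (N * |A|) * ∑' y, |η.charge y| * weight y ≤ S η) :
    ∀ᵐ η ∂μ₀, |H fun l => η.pair (h l)| ≤ K * Real.exp (S η) := by
  filter_upwards [hS] with η hη
  refine (hH.abs_le (T := |A| * ∑' y, |η.charge y| * weight y) fun l => ?_).trans ?_
  · refine η.abs_pair_le fun y => ?_
    exact (hH.test_le l y).trans (mul_le_mul_of_nonneg_right (le_abs_self A) (weight_pos y).le)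
  · refine mul_le_mul_of_nonneg_left (Real.exp_le_exp.2 ?_) hH.K_nonneg
    refine le_trans (le_of_eq ?_) hη
    ring

/-- The weight `exp (-U_g)` and its product with an exponentially bounded observable are
integrable. -/
theorem IsFreeGas.integrable_exp_neg_interaction (hz : 0 ≤ z) (hC : 0 ≤ C)
    (hrC : r (Set.Icc (-C) C)ᶜ = 0) (hμ₀ : IsFreeGas z r μ₀) (hv : IsAttractive v b) (hb : 0 < b)
    (hG : Integrable G) (hG0 : ∀ x, 0 ≤ G x) {g : Space d → ℝ} (hgc : Continuous g)
    (hgs : HasCompactSupport g) (hg0 : ∀ x, 0 ≤ g x) (hH : IsTameObservable H h K κ A) :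
    Integrable (fun η : Config d C => Real.exp (-interaction G v g η)) μ₀ ∧
      Integrable (fun η : Config d C =>
        (H fun l => η.pair (h l)) * Real.exp (-interaction G v g η)) μ₀ := by
  have hκ := hH.κ_nonneg
  obtain ⟨Gs, S, Z, hGc, hGs, hGs0, hZi, hae⟩ := hμ₀.exists_interaction_approx hz hC hrC hv hb hG
    hG0 hgc hgs hgc hgs hg0 (fun x => le_rfl) (c := κ * (N * |A|)) (by positivity)
  have m : g ∈ ({g, g} : Set (Space d → ℝ)) := Or.inl rfl
  have hFb := IsFreeGas.ae_abs_observable_le hH (hae.mono fun η hη => hη.2.1)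
  have hUl : AEStronglyMeasurable (interaction (C := C) G v g) μ₀ :=
    aestronglyMeasurable_of_tendsto_ae atTop
      (fun n => (measurable_interaction hv (hGc n) (hGs n) hgc hgs hg0).aestronglyMeasurable)
      (hae.mono fun η hη => (hη.2.2 g m).2.2)
  have hE : AEStronglyMeasurable (fun η => Real.exp (-interaction (C := C) G v g η)) μ₀ :=
    Real.continuous_exp.comp_aestronglyMeasurable hUl.neg
  constructor
  · refine hZi.mono' hE ?_
    filter_upwards [hae] with η hη
    have hU := (hη.2.2 g m).1
    rw [Real.norm_of_nonneg (Real.exp_nonneg _)]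
    refine le_trans (Real.exp_le_exp.2 ?_) hη.1
    linarith [(abs_le.1 hU).1, (abs_nonneg _).trans hU]
  · refine (hZi.const_mul K).mono' (hH.measurable.aestronglyMeasurable.mul hE) ?_
    filter_upwards [hae, hFb] with η hη hF
    have hU := (hη.2.2 g m).1
    rw [norm_mul, Real.norm_eq_abs, Real.norm_of_nonneg (Real.exp_nonneg _)]
    calc _ ≤ K * Real.exp (S η) * Real.exp (S η) := by
          refine mul_le_mul hF (Real.exp_le_exp.2 ?_) (Real.exp_nonneg _)
            (mul_nonneg hH.K_nonneg (Real.exp_nonneg _))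
          linarith [(abs_le.1 hU).1]
      _ = K * Real.exp (2 * S η) := by rw [mul_assoc, ← Real.exp_add, two_mul]
      _ ≤ K * Z η := mul_le_mul_of_nonneg_left hη.1 hH.K_nonneg

/-- The correlation inequality for a nonnegative increasing observable and an integrable kernel. -/
theorem IsFreeGas.correlation_le (hz : 0 ≤ z) (hC : 0 ≤ C)
    (hrC : r (Set.Icc (-C) C)ᶜ = 0) (hμ₀ : IsFreeGas z r μ₀) (hv : IsAttractive v b) (hb : 0 < b)
    (hG : Integrable G) (hG0 : ∀ x, 0 ≤ G x) (hg₁c : Continuous g₁)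
    (hg₁s : HasCompactSupport g₁) (hg₂c : Continuous g₂) (hg₂s : HasCompactSupport g₂)
    (hg₁ : ∀ x, 0 ≤ g₁ x) (hg : ∀ x, g₁ x ≤ g₂ x) (hH : IsNonnegIncreasing H h K κ A) :
    (∫ η, (H fun l => η.pair (h l)) * Real.exp (-interaction G v g₁ η) ∂μ₀) *
        ∫ η, Real.exp (-interaction G v g₂ η) ∂μ₀ ≤
      (∫ η, (H fun l => η.pair (h l)) * Real.exp (-interaction G v g₂ η) ∂μ₀) *
        ∫ η, Real.exp (-interaction G v g₁ η) ∂μ₀ := by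
  have hκ := hH.κ_nonneg
  have hg₂ : ∀ x, 0 ≤ g₂ x := fun x => (hg₁ x).trans (hg x)
  obtain ⟨Gs, S, Z, hGc, hGs, hGs0, hZi, hae⟩ := hμ₀.exists_interaction_approx hz hC hrC hv hb hG
    hG0 hg₁c hg₁s hg₂c hg₂s hg₁ hg (c := κ * (N * |A|)) (by positivity)
  have m₁ : g₁ ∈ ({g₁, g₂} : Set (Space d → ℝ)) := Or.inl rfl
  have m₂ : g₂ ∈ ({g₁, g₂} : Set (Space d → ℝ)) := Or.inr rfl
  have hFb := IsFreeGas.ae_abs_observable_le hH.toIsTameObservable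
    (hae.mono fun η hη => hη.2.1)
  exact correlation_le_of_tendsto (F := fun _ η => H fun l => η.pair (h l))
    (V := fun m => interaction (Gs m) v g₁) (W := fun m => interaction (Gs m) v g₂) (S := S)
    (Z := Z) (K := K) (fun _ => hH.measurable.aestronglyMeasurable)
    (fun m => (measurable_interaction hv (hGc m) (hGs m) hg₁c hg₁s hg₁).aestronglyMeasurable)
    (fun m => (measurable_interaction hv (hGc m) (hGs m) hg₂c hg₂s hg₂).aestronglyMeasurable)
    (fun _ => hFb) (fun m => hae.mono fun η hη => (hη.2.2 g₁ m₁).2.1 m)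
    (fun m => hae.mono fun η hη => (hη.2.2 g₂ m₂).2.1 m) hZi (hae.mono fun η hη => hη.1)
    (ae_of_all _ fun η => tendsto_const_nhds) (hae.mono fun η hη => (hη.2.2 g₁ m₁).2.2)
    (hae.mono fun η hη => (hη.2.2 g₂ m₂).2.2) fun m =>
      hμ₀.correlation_le_of_continuous hz hC hrC hv (hGc m) (hGs m) (hGs0 m) hg₁c hg₁s hg₂c
        hg₂s hg₁ hg hH

/-- Pass from `x` to `y` by raising one coordinate at a time. -/
lemma monotone_of_monotone_update {N : ℕ} {H : (Fin N → ℝ) → ℝ}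
    (hH : ∀ (x : Fin N → ℝ) (l : Fin N), Monotone fun t : ℝ => H (Function.update x l t)) :
    Monotone H := by
  intro x y hxy
  have key : ∀ s : Finset (Fin N), H x ≤ H (s.piecewise y x) := by
    intro s
    induction s using Finset.induction_on with
    | empty => simp
    | insert l s hl ih =>
      refine ih.trans ?_
      rw [Finset.piecewise_insert]
      have := hH (s.piecewise y x) l (hxy l)
      simp only at this
      rwa [show Function.update (s.piecewise y x) l (x l) = s.piecewise y x from by
        rw [← Finset.piecewise_eq_of_notMem s y x hl, Function.update_eq_self]] at this
  simpa using key Finset.univ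

lemma IsFastFalling.exists_le_weight {h : Space d → ℝ} (hh : IsFastFalling h) :
    ∃ B, ∀ y, |h y| ≤ B * weight y := by
  obtain ⟨B, hB⟩ := hh.2 (d + 1)
  refine ⟨B, fun y => ?_⟩
  have hp : (0 : ℝ) < (1 + ‖y‖ ^ 2) ^ (((d : ℝ) + 1) / 2) := Real.rpow_pos_of_pos (by positivity) _
  rw [weight_eq_inv, ← div_eq_mul_inv, le_div_iff₀ hp]
  refine le_trans ?_ (hB y)
  rw [abs_mul, mul_comm, abs_of_nonneg (a := (1 + ‖y‖ ^ 2) ^ (d + 1)) (by positivity)]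
  refine mul_le_mul_of_nonneg_right ?_ (abs_nonneg _)
  rw [← Real.rpow_natCast (1 + ‖y‖ ^ 2) (d + 1)]
  refine Real.rpow_le_rpow_of_exponent_le (by nlinarith [sq_nonneg ‖y‖]) ?_
  push_cast
  linarith [Nat.cast_nonneg (α := ℝ) d]

lemma isAttractive_of_contDiff {v : ℝ → ℝ} {b : ℝ} (hv_zero : v 0 = 0) (hv_smooth : ContDiff ℝ 2 v)
    (hv_bound : ∀ t, |deriv v t| < b) (hv_concave : ConcaveOn ℝ Set.univ v)
    (hv_decr : ∀ t, deriv v t ≤ 0) : IsAttractive v b := by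
  have hd : Differentiable ℝ v := hv_smooth.differentiable (by norm_num)
  refine ⟨hv_zero, fun s t => ?_, hv_concave, antitone_of_deriv_nonpos hd hv_decr⟩
  exact convex_univ.norm_image_sub_le_of_norm_deriv_le (fun x _ => hd x)
    (fun x _ => (hv_bound x).le) (Set.mem_univ t) (Set.mem_univ s)

/-- Truncation from below turns an increasing observable into a nonnegative one. -/
lemma IsTameObservable.truncate (hH : IsTameObservable H h K κ A) (hHm : Monotone H)
    (hh0 : ∀ l y, 0 ≤ h l y) {L : ℝ} (hL : 0 ≤ L) :
    IsNonnegIncreasing (fun x => max (H x) (-L) + L) h (K + L) κ A where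
  cont := (hH.cont.max continuous_const).add continuous_const
  mono := fun x y hxy => by
    simp only
    gcongr
    exact hHm hxy
  nonneg := fun x => by linarith [le_max_right (H x) (-L)]
  κ_nonneg := hH.κ_nonneg
  K_nonneg := add_nonneg hH.K_nonneg hL
  le_exp := fun x => by
    rw [abs_of_nonneg (by linarith [le_max_right (H x) (-L)])]
    have h1 : max (H x) (-L) + L ≤ |H x| + L := by
      have : max (H x) (-L) ≤ |H x| :=
        max_le (le_abs_self _) (by linarith [abs_nonneg (H x)])
      linarith
    -- As the exponential is at least 1, the shift `L` is absorbed into the prefactor `K + L`.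
    have h2 : 1 ≤ Real.exp (κ * ∑ i, |x i|) :=
      Real.one_le_exp (mul_nonneg hH.κ_nonneg (Finset.sum_nonneg fun i _ => abs_nonneg _))
    nlinarith [hH.le_exp x]
  cont_test := hH.cont_test
  test_nonneg := hh0
  test_le := hH.test_le

end Main

end WeakAttraction

end

/-! ### Removal of the truncation and the theorem. -/

namespace WeakAttraction

open scoped Topology

/-- Monotonicity of Gibbs expectations follows from monotonicity for truncated observables. -/
lemma integral_le_integral_of_truncate {Ω : Type*} [MeasurableSpace Ω] {μ ν : Measure Ω}
    {F : Ω → ℝ} (hμ : Integrable F μ) (hν : Integrable F ν)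
    (h : ∀ n : ℕ, ∫ η, max (F η) (-n) ∂μ ≤ ∫ η, max (F η) (-n) ∂ν) :
    ∫ η, F η ∂μ ≤ ∫ η, F η ∂ν := by
  have key : ∀ ρ : Measure Ω, Integrable F ρ →
      Tendsto (fun n : ℕ => ∫ η, max (F η) (-n) ∂ρ) atTop (𝓝 (∫ η, F η ∂ρ)) := by
    intro ρ hρ
    refine tendsto_integral_of_dominated_convergence (fun η => |F η|) (fun n => ?_) hρ.abs
      (fun n => ae_of_all _ fun η => ?_) (ae_of_all _ fun η => ?_)
    · exact (continuous_id.max continuous_const).comp_aestronglyMeasurable hρ.aestronglyMeasurable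
    · have hn : (0 : ℝ) ≤ n := Nat.cast_nonneg n
      rw [Real.norm_eq_abs]
      refine abs_le.2 ⟨?_, ?_⟩
      · exact (neg_abs_le _).trans (le_max_left _ _)
      · exact max_le (le_abs_self _) (by linarith [abs_nonneg (F η)])
    · obtain ⟨m, hm⟩ := exists_nat_ge (-F η)
      refine tendsto_const_nhds.congr' ?_
      filter_upwards [eventually_ge_atTop m] with n hn
      have : (m : ℝ) ≤ n := by exact_mod_cast hn
      exact (max_eq_left (by linarith)).symm
  exact le_of_tendsto_of_tendsto' (key μ hμ) (key ν hν) h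

lemma integral_gibbs {d : ℕ} {C : ℝ} {G : Space d → ℝ} {v : ℝ → ℝ} {μ₀ : Measure (Config d C)}
    {g : Space d → ℝ} (F : Config d C → ℝ) :
    ∫ η, F η ∂gibbs G v μ₀ g = (∫ η, F η * Real.exp (-interaction G v g η) ∂μ₀) /
      ∫ η, Real.exp (-interaction G v g η) ∂μ₀ := by
  rw [gibbs, integral_tilted, ← integral_div]
  refine integral_congr_ae (ae_of_all _ fun η => ?_)
  simp only [smul_eq_mul]
  ring

end WeakAttraction

theorem proposition4p1 (d : ℕ) (hd : 1 ≤ d)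
    (z : ℝ) (hz : 0 < z) (C : ℝ) (hC : 0 < C)
    (r : MeasureTheory.Measure ℝ) (hr : MeasureTheory.IsProbabilityMeasure r)
    (hrC : r (Set.Icc (-C) C)ᶜ = 0) (hr0 : r {0} = 0)
    (G : WeakAttraction.Space d → ℝ) (hG_int : MeasureTheory.Integrable G)
    (hG_nonneg : ∀ x, 0 ≤ G x) (hG_symm : ∀ x, G (-x) = G x)
    (v : ℝ → ℝ) (hv_zero : v 0 = 0) (hv_smooth : ContDiff ℝ 2 v)
    (hv_bound : ∃ b : ℝ, 0 < b ∧ ∀ t, |deriv v t| < b)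
    (hv_concave : ConcaveOn ℝ Set.univ v) (hv_decr : ∀ t, deriv v t ≤ 0)
    (μ₀ : MeasureTheory.Measure (WeakAttraction.Config d C))
    (hμ₀ : WeakAttraction.IsFreeGas z r μ₀)
    (F : WeakAttraction.Config d C → ℝ) (hF : WeakAttraction.IsIncreasingObservable F)
    (g₁ g₂ : WeakAttraction.Space d → ℝ)
    (hg₁_cont : Continuous g₁) (hg₁_supp : HasCompactSupport g₁) (hg₁_nonneg : ∀ x, 0 ≤ g₁ x)
    (hg₂_cont : Continuous g₂) (hg₂_supp : HasCompactSupport g₂) (hg₂_nonneg : ∀ x, 0 ≤ g₂ x)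
    (hg : ∀ x, g₁ x ≤ g₂ x) :
    (MeasureTheory.IsProbabilityMeasure (WeakAttraction.gibbs G v μ₀ g₁) ∧
      MeasureTheory.Integrable F (WeakAttraction.gibbs G v μ₀ g₁)) ∧
    (MeasureTheory.IsProbabilityMeasure (WeakAttraction.gibbs G v μ₀ g₂) ∧
      MeasureTheory.Integrable F (WeakAttraction.gibbs G v μ₀ g₂)) ∧
    ∫ η, F η ∂(WeakAttraction.gibbs G v μ₀ g₁) ≤ ∫ η, F η ∂(WeakAttraction.gibbs G v μ₀ g₂) := by
  have := hr
  have := hμ₀.isProbabilityMeasure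
  obtain ⟨b, hb, hvb⟩ := hv_bound
  have hv : WeakAttraction.IsAttractive v b :=
    WeakAttraction.isAttractive_of_contDiff hv_zero hv_smooth hvb hv_concave hv_decr
  obtain ⟨n, H, h, hHc, ⟨κ, K, hκ, hK, hHb⟩, hHm, hhf, hh0, hF⟩ := hF
  obtain rfl : F = fun η => H fun l => η.pair (h l) := funext hF
  choose B hB using fun l => (hhf l).exists_le_weight
  have hH : WeakAttraction.IsTameObservable H h K κ (∑ i, |B i|) :=
    ⟨hHc, hκ.le, hK.le, hHb, fun l => (hhf l).1, fun l y =>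
      (hB l y).trans (mul_le_mul_of_nonneg_right ((le_abs_self _).trans
        (Finset.single_le_sum (f := fun i => |B i|) (fun i _ => abs_nonneg _)
          (Finset.mem_univ l))) (WeakAttraction.weight_pos y).le)⟩
  have hint : ∀ g : WeakAttraction.Space d → ℝ, Continuous g → HasCompactSupport g →
      (∀ x, 0 ≤ g x) →
      IsProbabilityMeasure (WeakAttraction.gibbs G v μ₀ g) ∧
        Integrable (fun η => H fun l => η.pair (h l)) (WeakAttraction.gibbs G v μ₀ g) ∧
        0 < ∫ η, Real.exp (-WeakAttraction.interaction G v g η) ∂μ₀ := by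
    intro g hgc hgs hg0
    obtain ⟨h1, h2⟩ := hμ₀.integrable_exp_neg_interaction hz.le hC.le hrC hv hb hG_int hG_nonneg
      hgc hgs hg0 hH
    refine ⟨isProbabilityMeasure_tilted h1, (integrable_tilted_iff h1 _).2 ?_,
      integral_exp_pos h1⟩
    simpa only [smul_eq_mul, mul_comm] using h2
  obtain ⟨p₁, i₁, z₁⟩ := hint g₁ hg₁_cont hg₁_supp hg₁_nonneg
  obtain ⟨p₂, i₂, z₂⟩ := hint g₂ hg₂_cont hg₂_supp hg₂_nonneg
  -- The four functions argument needs a nonnegative observable, so it is applied to `max F (-L) +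
  -- L`. Both Gibbs measures have mass 1, so the added `L` cancels from the comparison, and `L → ∞`
  -- recovers `F`.
  refine ⟨⟨p₁, i₁⟩, ⟨p₂, i₂⟩, WeakAttraction.integral_le_integral_of_truncate i₁ i₂ fun L => ?_⟩
  have hT := hμ₀.correlation_le hz.le hC.le hrC hv hb hG_int hG_nonneg hg₁_cont hg₁_supp hg₂_cont
    hg₂_supp hg₁_nonneg hg
    (hH.truncate (WeakAttraction.monotone_of_monotone_update hHm) hh0 (Nat.cast_nonneg L))
  have hshift : ∀ ρ : Measure (WeakAttraction.Config d C), IsProbabilityMeasure ρ →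
      Integrable (fun η => H fun l => η.pair (h l)) ρ →
      ∫ η, (max (H fun l => η.pair (h l)) (-L) + L) ∂ρ =
        ∫ η, max (H fun l => η.pair (h l)) (-L) ∂ρ + L := by
    intro ρ _ hi
    have hm : Integrable (fun η => max (H fun l => η.pair (h l)) (-(L : ℝ))) ρ :=
      hi.sup (integrable_const _)
    rw [integral_add hm (integrable_const _)]
    simp
  have hle := (div_le_div_iff₀ z₁ z₂).2 hT
  rw [← WeakAttraction.integral_gibbs, ← WeakAttraction.integral_gibbs,
    hshift _ p₁ i₁, hshift _ p₂ i₂] at hle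
  linarith
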